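/- Let $\bar\gamma_0>0$ be a constant and let $\gamma_n:[0,\infty)\to[0,\infty)$, $n\ge 1$, be measurable functions with $$\rho:=\sup_{n\ge1}\int_0^\infty\gamma_n(t)\,dt<1 .$$ Consider point processes on $\mathbb R$, i.e. random elements of the space of locally finite integer-valued measures on $\mathbb R$ with the vague topology (generated by the maps $\mu\mapsto\int\phi\,d\mu$, $\phi$ continuous with compact support) and its Borel $\sigma$-algebra. Let $N=\sum_{n\ge0}N^n$ be the Hawkes process with exciting functions $(\gamma_n)_{n\ge 1}$, immigration rate $\bar\gamma_0$ and empty history: $N^0$ is a homogeneous Poisson process of rate $\bar\gamma_0$ on $(0,\infty)$ (with no points in $(-\infty,0]$) and, for every $n\ge0$, conditionally on $N^0,\dots,N^n$, the process $N^{n+1}$ is an inhomogeneous Poisson process with intensity $\lambda^{n+1}_t=\int_{(0,t)}\gamma_{n+1}(t-s)\,N^n(ds)$ at time $t$. Let $N^\dagger=\sum_{n\ge0}N^{\dagger,n}$ be its stationary version: $N^{\dagger,0}$ is a homogeneous Poisson process of rate $\bar\gamma_0$ on $\mathbb R$ and, for every $n\ge0$, conditionally on $N^{\dagger,0},\dots,N^{\dagger,n}$,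 the process $N^{\dagger,n+1}$ is an inhomogeneous Poisson process with intensity $\lambda^{\dagger,n+1}_t=\int_{(-\infty,t)}\gamma_{n+1}(t-s)\,N^{\dagger,n}(ds)$. The processes $N$ and $N^\dagger$ may be defined on different probability spaces. For $s\in\mathbb R$ let $\theta_sN(A)=N(A+s)$, and let $\mu^+$ denote the restriction of a measure $\mu$ to $\mathbb R^+=[0,\infty)$. Then $N$ and $N^\dagger$ are almost surely locally finite, and the following holds. (i) $(\theta_sN)^+$ converges in distribution to $(N^\dagger)^+$ as $s\to\infty$; that is, the law of $(\theta_sN)^+$ converges weakly to the law of $(N^\dagger)^+$ as probability measures on the space of locally finite integer-valued measures with the vague topology. (ii) If moreover $\eta:=\sup_{n\ge1}\int_0^\infty t\,\gamma_n(t)\,dt<\infty$, then $(\theta_sN)^+$ converges in variation to $(N^\dagger)^+$ as $s\to\infty$; that is, $$\lim_{s\to\infty}\ \sup_{A}\bigl|\mathbb P\bigl((\theta_sN)^+\in A\bigr)-\mathbb P\bigl((N^\dagger)^+\in A\bigr)\bigr|=0,$$ the supremum being over all Borel sets $A$ of the vague topology. -/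

import Mathlib

open MeasureTheory ProbabilityTheory Filter Topology Set
open scoped NNReal ENNReal CompactlySupported

/-- A Borel measure on the line is a point measure if it takes (finite) integer values on bounded
Borel sets. -/
def IsPointMeasure (μ : Measure ℝ) : Prop :=
  ∀ B : Set ℝ, MeasurableSet B → Bornology.IsBounded B → ∃ k : ℕ, μ B = k

/-- The space of (locally finite) integer-valued measures on `ℝ`. -/
structure PointMeasure where
  toMeasure : Measure ℝ
  natValued : IsPointMeasure toMeasure

namespace PointMeasure

/-- The vague topology: the coarsest topology for which `μ ↦ ∫ φ dμ` is continuous for every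
continuous compactly supported `φ : ℝ → ℝ`. -/
noncomputable instance : TopologicalSpace PointMeasure :=
  TopologicalSpace.induced
    (fun (μ : PointMeasure) (φ : C_c(ℝ, ℝ)) => ∫ x, φ x ∂μ.toMeasure) inferInstance

/-- The Borel σ-algebra of the vague topology. -/
noncomputable instance : MeasurableSpace PointMeasure := borel PointMeasure

instance : BorelSpace PointMeasure := ⟨rfl⟩

/-- The shift `θ_s μ`, that is `θ_s μ (A) = μ (A + s)`. -/
noncomputable def shift (s : ℝ) (μ : PointMeasure) : PointMeasure where
  toMeasure := μ.toMeasure.map (fun x => x - s)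
  natValued := by
    intro B hB hb
    rw [Measure.map_apply (by fun_prop) hB]
    refine μ.natValued _ (hB.preimage (by fun_prop)) ?_
    obtain ⟨R, hR⟩ := hb.subset_closedBall s
    refine (Metric.isBounded_closedBall (x := s + s) (r := R)).subset fun x hx => ?_
    have h := hR hx
    rw [Metric.mem_closedBall, Real.dist_eq] at h ⊢
    rwa [show x - (s + s) = x - s - s by ring]

/-- The restriction `μ⁺` of a point measure to `ℝ⁺ = [0, ∞)`. -/
noncomputable def restrictNonneg (μ : PointMeasure) : PointMeasure where
  toMeasure := μ.toMeasure.restrict (Ici 0)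
  natValued := by
    intro B hB hb
    rw [Measure.restrict_apply hB]
    exact μ.natValued _ (hB.inter measurableSet_Ici) (hb.subset inter_subset_left)

open Classical in
/-- The superposition `∑ n, N n`; by convention the zero measure if the sum is not locally
finite. -/
noncomputable def superposition (N : ℕ → PointMeasure) : PointMeasure :=
  if h : IsPointMeasure (Measure.sum fun n => (N n).toMeasure) then
    ⟨Measure.sum fun n => (N n).toMeasure, h⟩
  else ⟨0, fun _ _ _ => ⟨0, by simp⟩⟩

end PointMeasure

/-- The weight at `k` of the Poisson law with mean `Λ ∈ [0, ∞]`; for `Λ = ∞` the law is concentrated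
at infinity. -/
noncomputable def poissonWeight (Λ : ℝ≥0∞) (k : ℕ) : ℝ :=
  if Λ = ∞ then 0 else Real.exp (-Λ.toReal) * Λ.toReal ^ k / (k.factorial : ℝ)

/-- Conditionally on the σ-algebra `𝒢`, the point process `N` is an inhomogeneous Poisson process
with (random) intensity function `lam ω : ℝ → [0, ∞]`: conditionally on `𝒢`, its counts on pairwise
disjoint bounded Borel sets `B i` are independent Poisson variables with means `∫_{B i} lam`. -/
def IsCondPoisson {Ω : Type*} [MeasurableSpace Ω] (P : Measure Ω) (𝒢 : MeasurableSpace Ω)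
    (N : Ω → PointMeasure) (lam : Ω → ℝ → ℝ≥0∞) : Prop :=
  ∀ (m : ℕ) (B : Fin m → Set ℝ) (k : Fin m → ℕ),
    (∀ i, MeasurableSet (B i)) → (∀ i, Bornology.IsBounded (B i)) →
    Pairwise (fun i j => Disjoint (B i) (B j)) →
    P⟦{ω | ∀ i, (N ω).toMeasure (B i) = k i} | 𝒢⟧
      =ᵐ[P] fun ω => ∏ i, poissonWeight (∫⁻ t in B i, lam ω t) (k i)

/-- The intensities of the successive generations of a Hawkes process living on the set of times
`I` (`I = (0, ∞)` for an empty history, `I = ℝ` for the stationary version), given the realization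
`N` of the generations. Immigrants (generation `0`) arrive at the constant rate `γ₀` on `I`, and
generation `n + 1` has intensity
`t ↦ ∫_{I ∩ (-∞, t)} γ_{n+1}(t - s) N^n(ds)`.
Only the functions `γ 1, γ 2, …`, at positive arguments, are used. -/
noncomputable def hawkesIntensity (I : Set ℝ) (γ₀ : ℝ≥0) (γ : ℕ → ℝ → ℝ≥0)
    (N : ℕ → PointMeasure) : ℕ → ℝ → ℝ≥0∞
  | 0 => fun t => I.indicator (fun _ => (γ₀ : ℝ≥0∞)) t
  | n + 1 => fun t => ∫⁻ s in I ∩ Iio t, (γ (n + 1) (t - s) : ℝ≥0∞) ∂(N n).toMeasure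

/-- The σ-algebra generated by the generations `N 0, …, N (n - 1)`; it is trivial for `n = 0`. -/
noncomputable abbrev pastGenerations {Ω : Type*} (N : ℕ → Ω → PointMeasure) (n : ℕ) : MeasurableSpace Ω :=
  ⨆ j : Fin n, MeasurableSpace.comap (N j) inferInstance

/-- `N 0, N 1, …` are the generations of a Hawkes process on the set of times `I` with immigration
rate `γ₀` and exciting functions `γ 1, γ 2, …`: the immigrants `N 0` form a Poisson process with
rate `γ₀` on `I`, and, conditionally on `N 0, …, N n`, the next generation `N (n + 1)` is an
inhomogeneous Poisson process with intensity `∫_{I ∩ (-∞, t)} γ_{n+1}(t - s) N^n(ds)`.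
(It follows that almost surely every `N n` is simple and carried by `I`, and that distinct
generations have no common points.) -/
structure IsHawkesGenerations {Ω : Type*} [MeasurableSpace Ω] (P : Measure Ω) (I : Set ℝ)
    (γ₀ : ℝ≥0) (γ : ℕ → ℝ → ℝ≥0) (N : ℕ → Ω → PointMeasure) : Prop where
  measurable : ∀ n, Measurable (N n)
  condPoisson : ∀ n, IsCondPoisson P (pastGenerations N n) (N n)
    (fun ω => hawkesIntensity I γ₀ γ (fun j => N j ω) n)

/-- Convergence in variation of `X s` to `Y` as `s → ∞`, where `X s` is defined on `(Ω, P)` and `Y`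
on `(Ω', P')`: `sup_A |P(X s ∈ A) - P'(Y ∈ A)| → 0`, with `A` ranging over the Borel sets. -/
def TendstoInVariation {Ω Ω' E : Type*} [MeasurableSpace Ω] [MeasurableSpace Ω']
    [MeasurableSpace E] (X : ℝ → Ω → E) (Y : Ω' → E) (P : Measure Ω) (P' : Measure Ω') : Prop :=
  Tendsto (fun s : ℝ => ⨆ A : {A : Set E // MeasurableSet A},
    |P.real {ω | X s ω ∈ A.1} - P'.real {ω | Y ω ∈ A.1}|) atTop (𝓝 0)

/-! Everything is read off from Laplace functionals. A Poisson process with intensity `λ` satisfies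
`E exp(-∫ φ dN) = exp(-∫ (1 - e^{-φ}) λ)`, and this persists conditionally on the past
(`IsCondPoisson.lintegral_expNeg`). Integrating the generations out from the youngest to the oldest
replaces the test function `φ` by the exponent `V` of a whole cluster: the points of a generation
contribute `φ`, plus the integral of `1 - e^{-V}` of their children against the exciting function.
In the limit the functional of the Hawkes process is `exp(-γ₀ ∫_I (1 - e^{-V}))`, where `V` does not
depend on `I` (`IsHawkesGenerations.lintegral_expNeg`). Thus the empty-history and stationary
processes differ only through the domain of integration, that is, through the clusters of the
immigrants in `(-∞, 0]`.

For `φ = ∞` on a set `C`, `1 - e^{-V(u)}` is the probability that the cluster of an immigrant at `u`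
meets `C`. By a union bound over children its integral over the line is at most `|C| / (1 - ρ)`; for
`C = [0, ∞)` its integral over `u < 0` is at most `η / (1 - ρ)`. The tails over `u ≤ -s` therefore
vanish as `s → ∞`.

The comparison of the two laws needs no common probability space. Factorising the functional at time
`0` shows that on a window the stationary law is the convolution of the empty-history law with the
law contributed by the old immigrants, and the latter charges the zero measure with mass at least `1
- ε(s)`, `ε(s)` being `γ₀` times the tail above. Hence the stationary law is at least `1 - ε(s)`
times the other one (`map_window_le`), which bounds their distance in variation by `ε(s)`.

For (i), a vaguely open set is an increasing union of open sets depending on bounded windows, so one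
window at a time suffices. For (ii), the tail for `[0, ∞)` bounds all windows simultaneously, and
every Borel set is approximated by window events. -/

/-! ### The functions `exp (-x)` and `1 - exp (-x)` on `[0, ∞]` -/

/-- The function `x ↦ exp (-x)` from `[0, ∞]` to `[0, 1]`. -/
noncomputable def expNeg (x : ℝ≥0∞) : ℝ≥0∞ := EReal.exp (-(x : EReal))

lemma expNeg_zero : expNeg 0 = 1 := by simp [expNeg]

lemma expNeg_top : expNeg ∞ = 0 := by simp [expNeg]

lemma continuous_expNeg : Continuous expNeg :=
  ENNReal.continuous_exp.comp (continuous_neg.comp continuous_coe_ennreal_ereal)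

lemma measurable_expNeg : Measurable expNeg := continuous_expNeg.measurable

@[fun_prop]
lemma Measurable.expNeg {α : Type*} {m : MeasurableSpace α} {f : α → ℝ≥0∞} (hf : Measurable f) :
    Measurable fun x => expNeg (f x) := measurable_expNeg.comp hf

lemma expNeg_antitone : Antitone expNeg := fun _ _ h =>
  EReal.exp_monotone (EReal.neg_le_neg_iff.2 (EReal.coe_ennreal_le_coe_ennreal_iff.2 h))

lemma expNeg_le_one (x : ℝ≥0∞) : expNeg x ≤ 1 := by
  simpa [expNeg_zero] using expNeg_antitone (zero_le (a := x))

lemma expNeg_ne_top (x : ℝ≥0∞) : expNeg x ≠ ∞ := ne_top_of_le_ne_top (by simp) (expNeg_le_one x)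

lemma expNeg_of_ne_top {x : ℝ≥0∞} (hx : x ≠ ∞) :
    expNeg x = ENNReal.ofReal (Real.exp (-x.toReal)) := by
  lift x to ℝ≥0 using hx
  simp only [expNeg, ENNReal.coe_toReal]
  exact EReal.exp_coe (-(x : ℝ))

lemma expNeg_eq_zero {x : ℝ≥0∞} : expNeg x = 0 ↔ x = ∞ := by
  by_cases hx : x = ∞
  · simp [hx, expNeg_top]
  · simp [hx, expNeg_of_ne_top hx, Real.exp_pos]

lemma expNeg_add (x y : ℝ≥0∞) : expNeg (x + y) = expNeg x * expNeg y := by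
  by_cases hx : x = ∞
  · simp [hx, expNeg_top]
  by_cases hy : y = ∞
  · simp [hy, expNeg_top]
  rw [expNeg_of_ne_top hx, expNeg_of_ne_top hy, expNeg_of_ne_top (by simp [hx, hy]),
    ENNReal.toReal_add hx hy, neg_add, Real.exp_add, ENNReal.ofReal_mul (Real.exp_pos _).le]

lemma expNeg_sum {ι : Type*} (s : Finset ι) (f : ι → ℝ≥0∞) :
    expNeg (∑ i ∈ s, f i) = ∏ i ∈ s, expNeg (f i) := by
  classical
  induction s using Finset.induction_on with
  | empty => simp [expNeg_zero]
  | insert a s ha ih => rw [Finset.sum_insert ha, Finset.prod_insert ha, expNeg_add, ih]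

lemma expNeg_injective : Function.Injective expNeg := fun x y h => by
  have h1 := ENNReal.logOrderIso.symm.injective h
  exact EReal.coe_ennreal_injective (neg_injective h1)

/-- The function `x ↦ 1 - exp (-x)`: the probability that a Poisson variable with mean `x` does not
vanish. -/
noncomputable def hit (x : ℝ≥0∞) : ℝ≥0∞ := 1 - expNeg x

lemma hit_le_one (x : ℝ≥0∞) : hit x ≤ 1 := tsub_le_self

lemma hit_zero : hit 0 = 0 := by simp [hit, expNeg_zero]

lemma hit_top : hit ∞ = 1 := by simp [hit, expNeg_top]

lemma hit_add_expNeg (x : ℝ≥0∞) : hit x + expNeg x = 1 := tsub_add_cancel_of_le (expNeg_le_one x)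

lemma hit_mono : Monotone hit := fun _ _ h => tsub_le_tsub_left (expNeg_antitone h) 1

lemma continuous_hit : Continuous hit :=
  ENNReal.continuous_sub_left (by simp) |>.comp continuous_expNeg

lemma measurable_hit : Measurable hit := continuous_hit.measurable

@[fun_prop]
lemma Measurable.hit {α : Type*} {m : MeasurableSpace α} {f : α → ℝ≥0∞} (hf : Measurable f) :
    Measurable fun x => hit (f x) := measurable_hit.comp hf

lemma hit_le_self (x : ℝ≥0∞) : hit x ≤ x := by
  by_cases hx : x = ∞
  · simp [hx]
  rw [hit, expNeg_of_ne_top hx, ← ENNReal.ofReal_one, ← ENNReal.ofReal_sub _ (Real.exp_pos _).le]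
  refine ENNReal.ofReal_le_of_le_toReal ?_
  linarith [Real.add_one_le_exp (-x.toReal)]

lemma one_sub_le_expNeg (x : ℝ≥0∞) : 1 - x ≤ expNeg x := by
  rw [tsub_le_iff_left, ← hit_add_expNeg x]
  gcongr
  exact hit_le_self x

/-- Union bound for two independent Poisson variables, the second being nonzero with probability at
most `y`. It makes the cluster recursion linear. -/
lemma hit_add_le (x y : ℝ≥0∞) : hit (x + y) ≤ hit x + y := by
  rw [hit, tsub_le_iff_left, expNeg_add]
  calc (1 : ℝ≥0∞) = hit x + expNeg x * (hit y + expNeg y) := by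
        rw [hit_add_expNeg, mul_one, hit_add_expNeg]
    _ ≤ hit x + (1 * y + expNeg x * expNeg y) := by
        rw [mul_add]
        gcongr
        · exact expNeg_le_one x
        · exact hit_le_self y
    _ = _ := by ring

lemma hit_ne_zero {x : ℝ≥0∞} (hx : x ≠ 0) : hit x ≠ 0 := by
  intro h
  have h1 := hit_add_expNeg x
  rw [h, zero_add, ← expNeg_zero] at h1
  exact hx (expNeg_injective h1)

/-! ### Laplace functionals of conditional Poisson processes -/

lemma poissonWeight_nonneg (Λ : ℝ≥0∞) (k : ℕ) : 0 ≤ poissonWeight Λ k := by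
  unfold poissonWeight
  split_ifs
  · rfl
  · positivity

/-- The Laplace transform of the Poisson law. -/
lemma tsum_expNeg_mul_poissonWeight {c : ℝ≥0∞} (hc : c ≠ 0) (hc' : c ≠ ∞) (Λ : ℝ≥0∞) :
    ∑' k : ℕ, expNeg (c * k) * ENNReal.ofReal (poissonWeight Λ k) = expNeg (hit c * Λ) := by
  by_cases hΛ : Λ = ∞
  · simp [hΛ, poissonWeight, ENNReal.mul_top (hit_ne_zero hc), expNeg_top]
  have hfin : hit c * Λ ≠ ∞ :=
    ENNReal.mul_ne_top (ne_top_of_le_ne_top (by simp) (hit_le_one c)) hΛ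
  have hs := (NormedSpace.expSeries_div_hasSum_exp (𝔸 := ℝ) (Λ.toReal * Real.exp (-c.toReal)))
  rw [← Real.exp_eq_exp_ℝ] at hs
  have hs' := hs.mul_left (Real.exp (-Λ.toReal))
  have hterm : ∀ k : ℕ, expNeg (c * k) * ENNReal.ofReal (poissonWeight Λ k) = ENNReal.ofReal
      (Real.exp (-Λ.toReal) * ((Λ.toReal * Real.exp (-c.toReal)) ^ k / (k.factorial : ℝ))) := by
    intro k
    rw [expNeg_of_ne_top (ENNReal.mul_ne_top hc' (by simp)), poissonWeight, if_neg hΛ,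
      ← ENNReal.ofReal_mul (Real.exp_pos _).le, ENNReal.toReal_mul, ENNReal.toReal_natCast,
      mul_pow, ← Real.exp_nat_mul]
    congr 1
    rw [show -(c.toReal * k) = k * -c.toReal by ring]
    ring
  simp_rw [hterm]
  rw [← ENNReal.ofReal_tsum_of_nonneg (fun k => by positivity) hs'.summable, hs'.tsum_eq,
    expNeg_of_ne_top hfin, ← Real.exp_add, hit, expNeg_of_ne_top hc', ENNReal.toReal_mul,
    ← ENNReal.ofReal_one, ← ENNReal.ofReal_sub _ (Real.exp_pos _).le, ENNReal.toReal_ofReal]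
  · congr 2
    ring
  · simp

lemma ENNReal.tsum_prod_fin (m : ℕ) (f : Fin m → ℕ → ℝ≥0∞) :
    ∑' k : Fin m → ℕ, ∏ i, f i (k i) = ∏ i, ∑' j, f i j := by
  induction m with
  | zero => simp
  | succ m ih =>
    rw [← (Fin.consEquiv fun _ : Fin (m + 1) => ℕ).tsum_eq, ENNReal.tsum_prod', Fin.prod_univ_succ]
    simp_rw [← ih, ← ENNReal.tsum_mul_right, ← ENNReal.tsum_mul_left]
    simp [Fin.consEquiv, Fin.prod_univ_succ]

/-- On `𝒢` the measures `P` restricted to `E` and `P` with density the conditional probability of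
`E` coincide. Comparing measures avoids any integrability assumption on `Z`. -/
lemma lintegral_indicator_eq_of_condExp_indicator {Ω : Type*} {𝒢 mΩ : MeasurableSpace Ω}
    {P : Measure Ω} [IsProbabilityMeasure P] (h𝒢 : 𝒢 ≤ mΩ)
    {Z : Ω → ℝ≥0∞} (hZ : Measurable[𝒢] Z) {E : Set Ω} (hE : MeasurableSet E) {g : Ω → ℝ}
    (hg : P⟦E | 𝒢⟧ =ᵐ[P] g) :
    ∫⁻ ω, E.indicator Z ω ∂P = ∫⁻ ω, Z ω * ENNReal.ofReal (g ω) ∂P := by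
  have hZ' : Measurable Z := hZ.mono h𝒢 le_rfl
  set f : Ω → ℝ≥0∞ := fun ω => ENNReal.ofReal ((P⟦E | 𝒢⟧) ω) with hf
  have hfm : Measurable f :=
    (stronglyMeasurable_condExp.measurable.mono h𝒢 le_rfl).ennreal_ofReal
  have hint : Integrable (E.indicator fun _ : Ω => (1 : ℝ)) P :=
    (integrable_const _).indicator hE
  have hpos : 0 ≤ᵐ[P] P⟦E | 𝒢⟧ :=
    condExp_nonneg (.of_forall fun ω => indicator_nonneg (fun _ _ => zero_le_one) ω)
  have hμ : (P.restrict E).trim h𝒢 = (P.withDensity f).trim h𝒢 := by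
    refine @Measure.ext _ 𝒢 _ _ fun s hs => ?_
    rw [trim_measurableSet_eq h𝒢 hs, trim_measurableSet_eq h𝒢 hs,
      Measure.restrict_apply (h𝒢 s hs), withDensity_apply _ (h𝒢 s hs), hf,
      ← ofReal_integral_eq_lintegral_ofReal integrable_condExp.integrableOn
        (ae_restrict_of_ae hpos), setIntegral_condExp h𝒢 hint hs,
      integral_indicator_const _ hE, measureReal_restrict_apply hE]
    simp [inter_comm]
  calc ∫⁻ ω, E.indicator Z ω ∂P = ∫⁻ ω, Z ω ∂(P.restrict E).trim h𝒢 := by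
        rw [lintegral_indicator hE, lintegral_trim h𝒢 hZ]
    _ = ∫⁻ ω, f ω * Z ω ∂P := by
        rw [hμ, lintegral_trim h𝒢 hZ, lintegral_withDensity_eq_lintegral_mul _ hfm hZ']
        rfl
    _ = _ := by
        refine lintegral_congr_ae ?_
        filter_upwards [hg] with ω hω
        rw [hf, mul_comm]
        simp only [hω]

lemma PointMeasure.apply_ne_top (μ : PointMeasure) {B : Set ℝ} (hB : Bornology.IsBounded B) :
    μ.toMeasure B ≠ ∞ := by
  obtain ⟨R, hR⟩ := hB.subset_closedBall 0
  obtain ⟨k, hk⟩ := μ.natValued _ measurableSet_closedBall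
    (Metric.isBounded_closedBall (x := (0 : ℝ)) (r := R))
  exact ne_top_of_le_ne_top (by rw [hk]; simp) (measure_mono hR)

instance (μ : PointMeasure) : IsLocallyFiniteMeasure μ.toMeasure where
  finiteAtNhds x := ⟨Metric.ball x 1, Metric.ball_mem_nhds x one_pos,
    (μ.apply_ne_top Metric.isBounded_ball).lt_top⟩

section Counts

variable {Ω : Type*} {𝒢 mΩ : MeasurableSpace Ω} {P : Measure Ω} [IsProbabilityMeasure P]
  {N : Ω → PointMeasure} {lam : Ω → ℝ → ℝ≥0∞}

/-- The conditional Laplace transform of finitely many counts of a conditional Poisson process. -/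
lemma IsCondPoisson.lintegral_prod_expNeg (h : IsCondPoisson P 𝒢 N lam) (h𝒢 : 𝒢 ≤ mΩ)
    (hN : ∀ B, MeasurableSet B → Measurable fun ω => (N ω).toMeasure B)
    {Z : Ω → ℝ≥0∞} (hZ : Measurable[𝒢] Z) {m : ℕ} (B : Fin m → Set ℝ) (c : Fin m → ℝ≥0∞)
    (hB : ∀ i, MeasurableSet (B i)) (hb : ∀ i, Bornology.IsBounded (B i))
    (hd : Pairwise fun i j => Disjoint (B i) (B j)) (hc : ∀ i, c i ≠ 0) (hc' : ∀ i, c i ≠ ∞) :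
    ∫⁻ ω, Z ω * ∏ i, expNeg (c i * (N ω).toMeasure (B i)) ∂P =
      ∫⁻ ω, Z ω * ∏ i, expNeg (hit (c i) * ∫⁻ t in B i, lam ω t) ∂P := by
  have hZ' : Measurable Z := hZ.mono h𝒢 le_rfl
  -- The events `E k` partition the space according to the vector of counts, so both sides become
  -- sums over `k`.
  set E : (Fin m → ℕ) → Set Ω := fun k => {ω | ∀ i, (N ω).toMeasure (B i) = k i} with hE
  have hEm : ∀ k, MeasurableSet (E k) := fun k => by
    rw [hE]
    simp only [ofPred_forall]
    exact MeasurableSet.iInter fun i => hN _ (hB i) (measurableSet_singleton _)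
  have hcond := fun k => h m B k hB hb hd
  set w : (Fin m → ℕ) → Ω → ℝ := fun k ω => ∏ i, poissonWeight (∫⁻ t in B i, lam ω t) (k i)
  have hw : ∀ k, AEMeasurable (fun ω => ENNReal.ofReal (w k ω)) P := fun k =>
    AEMeasurable.ennreal_ofReal ((stronglyMeasurable_condExp.measurable.mono h𝒢
      le_rfl).aemeasurable.congr (hcond k))
  set a : (Fin m → ℕ) → ℝ≥0∞ := fun k => ∏ i, expNeg (c i * k i)
  have h1 : ∀ ω, Z ω * ∏ i, expNeg (c i * (N ω).toMeasure (B i)) =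
      ∑' k, a k * (E k).indicator Z ω := by
    intro ω
    choose κ hκ using fun i => (N ω).natValued (B i) (hB i) (hb i)
    rw [tsum_eq_single κ]
    · rw [indicator_of_mem (show ω ∈ E κ from hκ), mul_comm]
      simp only [hκ, a]
    · intro k hk
      rw [indicator_of_notMem, mul_zero]
      intro hω
      refine hk (funext fun i => ?_)
      exact_mod_cast (hω i).symm.trans (hκ i)
  have h2 : ∀ ω, Z ω * ∏ i, expNeg (hit (c i) * ∫⁻ t in B i, lam ω t) =
      ∑' k, a k * (Z ω * ENNReal.ofReal (w k ω)) := by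
    intro ω
    simp_rw [← tsum_expNeg_mul_poissonWeight (hc _) (hc' _), ← ENNReal.tsum_prod_fin,
      ← ENNReal.tsum_mul_left]
    refine tsum_congr fun k => ?_
    rw [Finset.prod_mul_distrib,
      ENNReal.ofReal_prod_of_nonneg fun i _ => poissonWeight_nonneg _ _]
    ring
  have hZw : ∀ k, AEMeasurable (fun ω => Z ω * ENNReal.ofReal (w k ω)) P := fun k =>
    hZ'.aemeasurable.mul (hw k)
  simp_rw [h1, h2]
  rw [lintegral_tsum fun k => ((hZ'.indicator (hEm k)).const_mul _).aemeasurable,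
    lintegral_tsum fun k => (hZw k).const_mul _]
  refine tsum_congr fun k => ?_
  rw [lintegral_const_mul _ (hZ'.indicator (hEm k)),
    lintegral_const_mul'' _ (hZw k),
    lintegral_indicator_eq_of_condExp_indicator h𝒢 hZ (hEm k) (hcond k)]

/-- The nonzero level sets of `f` are disjoint, bounded and Borel, so the joint law of their counts
applies. The level `0` is unbounded but contributes nothing, since `hit 0 = 0`. -/
lemma IsCondPoisson.lintegral_expNeg_simpleFunc (h : IsCondPoisson P 𝒢 N lam) (h𝒢 : 𝒢 ≤ mΩ)
    (hN : ∀ B, MeasurableSet B → Measurable fun ω => (N ω).toMeasure B)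
    (hlam : ∀ ω, Measurable (lam ω)) {Z : Ω → ℝ≥0∞} (hZ : Measurable[𝒢] Z)
    (f : SimpleFunc ℝ ℝ≥0∞) (hf : ∀ x, f x ≠ ∞) (hfb : Bornology.IsBounded (Function.support f)) :
    ∫⁻ ω, Z ω * expNeg (∫⁻ x, f x ∂(N ω).toMeasure) ∂P =
      ∫⁻ ω, Z ω * expNeg (∫⁻ t, hit (f t) * lam ω t) ∂P := by
  classical
  set s : Finset ℝ≥0∞ := f.range.erase 0
  let e := s.equivFin.symm
  have key : ∀ (g : ℝ≥0∞ → ℝ≥0∞) (μ : Measure ℝ), g 0 = 0 →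
      ∫⁻ x, g (f x) ∂μ = ∑ i, g (e i) * μ (f ⁻¹' {(e i : ℝ≥0∞)}) := by
    intro g μ hg
    have h1 : ∫⁻ x, g (f x) ∂μ = ∑ y ∈ s, g y * μ (f ⁻¹' {y}) := by
      have := (f.map g).lintegral_eq_lintegral μ
      rw [SimpleFunc.coe_map] at this
      simp only [Function.comp_def] at this
      rw [this, SimpleFunc.map_lintegral]
      refine (Finset.sum_subset (Finset.erase_subset _ _) fun y hy hy' => ?_).symm
      have : y = 0 := by simpa [s, hy] using hy'
      simp [this, hg]
    rw [h1, ← Finset.sum_coe_sort, ← e.sum_comp]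
  have hne : ∀ i, (e i : ℝ≥0∞) ≠ 0 := fun i => (Finset.mem_erase.1 (e i).2).1
  have := h.lintegral_prod_expNeg h𝒢 hN hZ (fun i => f ⁻¹' {(e i : ℝ≥0∞)}) (fun i => e i)
    (fun i => f.measurableSet_preimage _)
    (fun i => hfb.subset fun x hx => by
      simpa [Function.mem_support, mem_preimage.1 hx] using (show f x = e i from hx) ▸ hne i)
    (fun i j hij => Disjoint.preimage _ (by
      rw [disjoint_singleton]
      exact fun h => hij (e.injective (Subtype.ext h))))
    hne (fun i => by
      obtain ⟨x, hx⟩ := SimpleFunc.mem_range.1 (Finset.mem_of_mem_erase (e i).2)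
      exact hx ▸ hf x)
  simp_rw [← expNeg_sum] at this
  convert this using 5 with ω ω
  · exact key id _ rfl
  · have h2 := key hit (volume.withDensity (lam ω)) hit_zero
    rw [lintegral_withDensity_eq_lintegral_mul _ (hlam ω)
      (show Measurable fun t => hit (f t) from measurable_hit.comp f.measurable)] at h2
    simp only [Pi.mul_apply, mul_comm (lam ω _)] at h2
    rw [h2]
    refine Finset.sum_congr rfl fun i _ => ?_
    rw [withDensity_apply _ (f.measurableSet_preimage _)]

/-- The conditional Laplace functional of a conditional Poisson process. -/
theorem IsCondPoisson.lintegral_expNeg (h : IsCondPoisson P 𝒢 N lam) (h𝒢 : 𝒢 ≤ mΩ)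
    (hN : ∀ B, MeasurableSet B → Measurable fun ω => (N ω).toMeasure B)
    (hlam : ∀ ω, Measurable (lam ω))
    (hlam' : ∀ φ : ℝ → ℝ≥0∞, Measurable φ → Measurable fun ω => ∫⁻ t, φ t * lam ω t)
    {Z : Ω → ℝ≥0∞} (hZ : Measurable[𝒢] Z) (hZ1 : ∀ ω, Z ω ≤ 1) {φ : ℝ → ℝ≥0∞} (hφ : Measurable φ) :
    ∫⁻ ω, Z ω * expNeg (∫⁻ x, φ x ∂(N ω).toMeasure) ∂P =
      ∫⁻ ω, Z ω * expNeg (∫⁻ t, hit (φ t) * lam ω t) ∂P := by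
  have hZ' : Measurable Z := hZ.mono h𝒢 le_rfl
  have hN' : Measurable fun ω => (N ω).toMeasure := Measure.measurable_of_measurable_coe _ hN
  -- Cutting to `[-n, n]` gives bounded supports, and `eapprox` has finite values even where `φ =
  -- ∞`.
  let f : ℕ → SimpleFunc ℝ ℝ≥0∞ := fun n => (SimpleFunc.eapprox φ n).restrict (Icc (-n) n)
  have hf : ∀ n x, f n x = (Icc (-n : ℝ) n).indicator (SimpleFunc.eapprox φ n) x := fun n x =>
    SimpleFunc.restrict_apply _ measurableSet_Icc _
  have hmono : ∀ x, Monotone fun n => f n x := fun x n k hnk => by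
    simp only [hf]
    refine (indicator_le_indicator (SimpleFunc.monotone_eapprox φ hnk x)).trans ?_
    refine indicator_le_indicator_of_subset (Icc_subset_Icc ?_ ?_) (fun _ => zero_le) _
    · simpa using hnk
    · simpa using hnk
  have hlim : ∀ x, Tendsto (fun n => f n x) atTop (𝓝 (φ x)) := fun x => by
    refine (SimpleFunc.tendsto_eapprox hφ x).congr' ?_
    obtain ⟨n, hn⟩ := exists_nat_ge |x|
    filter_upwards [eventually_ge_atTop n] with k hk
    rw [hf, indicator_of_mem]
    exact abs_le.1 (hn.trans (by exact_mod_cast hk))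
  have key := fun n => h.lintegral_expNeg_simpleFunc h𝒢 hN hlam hZ (f n)
    (fun x => by
      rw [hf]
      exact ne_top_of_le_ne_top (SimpleFunc.eapprox_lt_top φ n x).ne (indicator_le_self _ _ _))
    ((Metric.isBounded_Icc (-n : ℝ) n).subset fun x hx => by
      rw [Function.mem_support, hf] at hx
      exact mem_of_indicator_ne_zero hx)
  have hlimit : ∀ G : ℕ → Ω → ℝ≥0∞, ∀ G' : Ω → ℝ≥0∞, (∀ n, Measurable (G n)) →
      (∀ ω, Tendsto (fun n => G n ω) atTop (𝓝 (G' ω))) →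
      Tendsto (fun n => ∫⁻ ω, Z ω * expNeg (G n ω) ∂P) atTop
        (𝓝 (∫⁻ ω, Z ω * expNeg (G' ω) ∂P)) := by
    intro G G' hG hGG'
    refine tendsto_lintegral_of_dominated_convergence (fun _ => 1)
      (fun n => hZ'.mul (measurable_expNeg.comp (hG n)))
      (fun n => .of_forall fun ω => mul_le_one' (hZ1 ω) (expNeg_le_one _)) (by simp)
      (.of_forall fun ω => ?_)
    exact ENNReal.Tendsto.const_mul ((continuous_expNeg.tendsto _).comp (hGG' ω))
      (.inr (ne_top_of_le_ne_top (by simp) (hZ1 ω)))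
  have hl := hlimit (fun n ω => ∫⁻ x, f n x ∂(N ω).toMeasure)
    (fun ω => ∫⁻ x, φ x ∂(N ω).toMeasure)
    (fun n => (Measure.measurable_lintegral (f n).measurable).comp hN') fun ω =>
      lintegral_tendsto_of_tendsto_of_monotone (fun n => (f n).measurable.aemeasurable)
        (.of_forall hmono) (.of_forall hlim)
  have hr := hlimit (fun n ω => ∫⁻ t, hit (f n t) * lam ω t) (fun ω => ∫⁻ t, hit (φ t) * lam ω t)
    (fun n => hlam' _ (measurable_hit.comp (f n).measurable)) fun ω =>
      lintegral_tendsto_of_tendsto_of_monotone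
        (fun n => ((measurable_hit.comp (f n).measurable).mul
          (hlam ω)).aemeasurable)
        (.of_forall fun x n k hnk => mul_le_mul_left (hit_mono (hmono x hnk)) _)
        (.of_forall fun x => ?_)
  · exact tendsto_nhds_unique (hl.congr key) hr
  -- The intensity may be infinite, and multiplication by `∞` is discontinuous at `0`; where `φ`
  -- vanishes the approximations vanish identically.
  · by_cases hx : φ x = 0
    · have h0 : ∀ n, f n x = 0 := fun n =>
        le_antisymm (hx ▸ (hmono x).ge_of_tendsto (hlim x) n) zero_le
      simp [h0, hx, hit_zero]
    · exact ENNReal.Tendsto.mul_const ((continuous_hit.tendsto _).comp (hlim x))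
        (.inl (hit_ne_zero hx))

end Counts

/-! ### The Borel σ-algebra of the vague topology -/

namespace PointMeasure

lemma continuous_integral (φ : C_c(ℝ, ℝ)) :
    Continuous fun μ : PointMeasure => ∫ x, φ x ∂μ.toMeasure :=
  (continuous_apply φ).comp (continuous_induced_dom
    (f := fun (μ : PointMeasure) (φ : C_c(ℝ, ℝ)) => ∫ x, φ x ∂μ.toMeasure))

lemma integrable (φ : C_c(ℝ, ℝ)) (μ : PointMeasure) : Integrable φ μ.toMeasure :=
  φ.continuous.integrable_of_hasCompactSupport φ.hasCompactSupport

/-- A continuous function on the line which vanishes off a bounded interval, as an element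
of `C_c(ℝ, ℝ)`. -/
noncomputable def ofIcc (f : ℝ → ℝ) (hf : Continuous f) (a b : ℝ)
    (h : ∀ x, x ∉ Icc a b → f x = 0) : C_c(ℝ, ℝ) where
  toFun := f
  continuous_toFun := hf
  hasCompactSupport' := HasCompactSupport.intro isCompact_Icc h

lemma measurable_apply_Ioo (a b : ℝ) :
    Measurable fun μ : PointMeasure => μ.toMeasure (Ioo a b) := by
  -- Continuous trapezoids increasing to the indicator of `(a, b)`.
  let g : ℕ → ℝ → ℝ := fun n x => min 1 (n * max 0 (min (x - a) (b - x)))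
  have hg : ∀ n, Continuous (g n) := fun n => by fun_prop
  have hg0 : ∀ n x, x ∉ Ioo a b → g n x = 0 := fun n x hx => by
    have : min (x - a) (b - x) ≤ 0 := by
      by_contra! h
      exact hx ⟨by linarith [lt_min_iff.1 h], by linarith [lt_min_iff.1 h]⟩
    simp [g, max_eq_left this]
  let φ : ℕ → C_c(ℝ, ℝ) := fun n => ofIcc (g n) (hg n) a b
    fun x hx => hg0 n x fun h => hx (Ioo_subset_Icc_self h)
  have hgpos : ∀ n x, 0 ≤ g n x := fun n x => by positivity
  refine measurable_of_tendsto_metrizable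
    (f := fun n (μ : PointMeasure) => ENNReal.ofReal (∫ x, φ n x ∂μ.toMeasure))
    (fun n => (continuous_integral (φ n)).measurable.ennreal_ofReal) ?_
  rw [tendsto_pi_nhds]
  intro μ
  simp_rw [fun n => ofReal_integral_eq_lintegral_ofReal (integrable (φ n) μ)
    (.of_forall (hgpos n)), ← lintegral_indicator_one measurableSet_Ioo]
  refine lintegral_tendsto_of_tendsto_of_monotone
    (fun n => (hg n).measurable.ennreal_ofReal.aemeasurable)
    (.of_forall fun x n k hnk => ENNReal.ofReal_le_ofReal ?_) (.of_forall fun x => ?_)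
  · change g n x ≤ g k x
    simp only [g]
    gcongr
  · by_cases hx : x ∈ Ioo a b
    · rw [indicator_of_mem hx, Pi.one_apply, ← ENNReal.ofReal_one]
      refine ENNReal.tendsto_ofReal (tendsto_const_nhds.congr' ?_)
      have hpos : 0 < min (x - a) (b - x) := lt_min (by linarith [hx.1]) (by linarith [hx.2])
      obtain ⟨n, hn⟩ := exists_nat_ge (min (x - a) (b - x))⁻¹
      filter_upwards [eventually_ge_atTop n] with k hk
      refine (min_eq_left ?_).symm
      rw [max_eq_right hpos.le]
      calc (1 : ℝ) = (min (x - a) (b - x))⁻¹ * min (x - a) (b - x) := (inv_mul_cancel₀ hpos.ne').symm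
        _ ≤ k * min (x - a) (b - x) := by
          gcongr
          exact hn.trans (by exact_mod_cast hk)
    · rw [indicator_of_notMem hx]
      refine tendsto_const_nhds.congr fun n => ?_
      exact (by simp [hg0 n x hx] : (0 : ℝ≥0∞) = ENNReal.ofReal (g n x))

/-- The counts on rational intervals determine the σ-algebra on point measures. -/
lemma measurable_toMeasure_of_Ioo {α : Type*} {m : MeasurableSpace α} {F : α → PointMeasure}
    (hF : ∀ a b : ℚ, Measurable fun x => (F x).toMeasure (Ioo (a : ℝ) b)) :
    Measurable fun x => (F x).toMeasure := by
  refine Measure.measurable_of_measurable_coe _ fun B hB => ?_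
  -- The π-system argument requires finite measures, hence the localisation to bounded intervals.
  have hk : ∀ k : ℕ, Measurable fun x => (F x).toMeasure.restrict (Ioo (-k : ℝ) k) := by
    intro k
    have : ∀ x, IsFiniteMeasure ((F x).toMeasure.restrict (Ioo (-k : ℝ) k)) :=
      fun x => ⟨by
        rw [Measure.restrict_apply_univ]
        exact ((F x).apply_ne_top (Metric.isBounded_Ioo _ _)).lt_top⟩
    refine Measurable.measure_of_isPiSystem
      ((BorelSpace.measurable_eq (α := ℝ)).trans Real.borel_eq_generateFrom_Ioo_rat)
      Real.isPiSystem_Ioo_rat ?_ ?_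
    · intro s hs
      simp only [mem_iUnion, mem_singleton_iff] at hs
      obtain ⟨a, b, -, rfl⟩ := hs
      simp_rw [Measure.restrict_apply measurableSet_Ioo, Ioo_inter_Ioo]
      simpa using hF (max a (-k)) (min b k)
    · simp_rw [Measure.restrict_apply_univ]
      simpa using hF (-k) k
  have : ∀ x, (F x).toMeasure B = ⨆ k : ℕ, (F x).toMeasure.restrict (Ioo (-k : ℝ) k) B := by
    intro x
    rw [← Measure.restrict_iUnion_apply_eq_iSup _ hB]
    · rw [iUnion_eq_univ_iff.2 fun y => ?_, Measure.restrict_univ]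
      obtain ⟨k, hk⟩ := exists_nat_gt |y|
      exact ⟨k, abs_lt.1 hk⟩
    · refine Monotone.directed_le fun i j hij => Ioo_subset_Ioo ?_ ?_ <;> simpa using hij
  simp_rw [this]
  exact Measurable.iSup fun k => (Measure.measurable_coe hB).comp (hk k)

lemma measurable_toMeasure : Measurable toMeasure :=
  measurable_toMeasure_of_Ioo fun a b => measurable_apply_Ioo a b

lemma measurable_apply {B : Set ℝ} (hB : MeasurableSet B) :
    Measurable fun μ : PointMeasure => μ.toMeasure B :=
  (Measure.measurable_coe hB).comp measurable_toMeasure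

/-- `C(ℝ, ℝ)` with compact convergence is second countable, so its subspaces are separable; for
functions vanishing off `[-n, n]`, convergence on that compact interval is uniform on the line. -/
lemma exists_countable_uniform_approx (n : ℕ) :
    ∃ D : Set C_c(ℝ, ℝ), D.Countable ∧ (∀ d ∈ D, ∀ x ∉ Icc (-n : ℝ) n, d x = 0) ∧
      ∀ φ : C_c(ℝ, ℝ), (∀ x ∉ Icc (-n : ℝ) n, φ x = 0) → ∀ ε > 0, ∃ d ∈ D, ∀ x, |φ x - d x| < ε := by
  let T : Set C(ℝ, ℝ) := {f | ∀ x ∉ Icc (-n : ℝ) n, f x = 0}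
  obtain ⟨t, htc, htd⟩ := TopologicalSpace.exists_countable_dense T
  let ι : T → C_c(ℝ, ℝ) := fun f => ofIcc f.1 f.1.continuous (-n) n f.2
  refine ⟨ι '' t, htc.image _, ?_, fun φ hφ ε hε => ?_⟩
  · rintro _ ⟨f, -, rfl⟩
    exact f.2
  · let f : T := ⟨φ.toContinuousMap, hφ⟩
    have hU : {g : C(ℝ, ℝ) | ∀ x ∈ Icc (-n : ℝ) n, dist (φ x) (g x) < ε} ∈ 𝓝 f.1 :=
      Metric.tendstoUniformlyOn_iff.1
        (ContinuousMap.tendsto_iff_forall_isCompact_tendstoUniformlyOn.1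
          (tendsto_id (x := 𝓝 f.1)) _ isCompact_Icc) ε hε
    obtain ⟨d, hd, hdt⟩ := mem_closure_iff_nhds.1 (htd f) _
      (continuous_subtype_val.continuousAt.preimage_mem_nhds hU)
    refine ⟨ι d, mem_image_of_mem _ hdt, fun x => ?_⟩
    by_cases hx : x ∈ Icc (-n : ℝ) n
    · exact hd x hx
    · have : (ι d) x = 0 := d.2 x hx
      simpa [hφ x hx, this] using hε

/-- The vague topology is induced by countably many test functions. -/
lemma exists_countable_testFunctions : ∃ D : Set C_c(ℝ, ℝ), D.Countable ∧
    ∀ φ : C_c(ℝ, ℝ), Continuous[TopologicalSpace.induced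
      (fun (μ : PointMeasure) (d : D) => ∫ x, d.1 x ∂μ.toMeasure) inferInstance, inferInstance]
      fun μ : PointMeasure => ∫ x, φ x ∂μ.toMeasure := by
  choose D hDc hD0 hD using exists_countable_uniform_approx
  -- The plateau functions `χ n` are added to the family because `∫ χ n dμ` bounds the mass of `[-n,
  -- n]`: it turns uniform closeness of test functions into closeness of integrals, and stays below
  -- `c` near `μ₀`.
  let χ : ℕ → C_c(ℝ, ℝ) := fun n => ofIcc (fun x => max 0 (min 1 (n + 1 - |x|))) (by fun_prop)
    (-(n + 1)) (n + 1) fun x hx => by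
      have : n + 1 - |x| ≤ 0 := by
        by_contra! h
        exact hx (abs_le.1 (by linarith))
      simp [(min_le_right _ _).trans this]
  have hχ0 : ∀ (n : ℕ) x, 0 ≤ χ n x := fun n x => le_max_left 0 _
  have hχ1 : ∀ n : ℕ, ∀ x ∈ Icc (-n : ℝ) n, χ n x = 1 := fun n x hx => by
    have h : |x| ≤ n := abs_le.2 hx
    change max 0 (min 1 (n + 1 - |x|)) = 1
    rw [min_eq_left (by linarith), max_eq_right zero_le_one]
  let D' : Set C_c(ℝ, ℝ) := (⋃ n, D n) ∪ range χ
  refine ⟨D', (countable_iUnion hDc).union (countable_range χ), fun φ => ?_⟩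
  let τ : TopologicalSpace PointMeasure := TopologicalSpace.induced
      (fun (μ : PointMeasure) (d : D') => ∫ x, d.1 x ∂μ.toMeasure) inferInstance
  have hcont : ∀ d ∈ D', Continuous[τ, inferInstance]
      fun μ : PointMeasure => ∫ x, d x ∂μ.toMeasure := fun d hd =>
    (continuous_apply (⟨d, hd⟩ : D')).comp (continuous_induced_dom
      (f := fun (μ : PointMeasure) (d : D') => ∫ x, d.1 x ∂μ.toMeasure))
  obtain ⟨R, hR⟩ := φ.hasCompactSupport.isCompact.isBounded.subset_closedBall 0
  obtain ⟨n, hn⟩ := exists_nat_ge R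
  have hφ0 : ∀ x ∉ Icc (-n : ℝ) n, φ x = 0 := fun x hx => by
    by_contra h
    have h1 := hR (subset_tsupport _ (Function.mem_support.2 h))
    rw [mem_closedBall_zero_iff, Real.norm_eq_abs] at h1
    exact hx (abs_le.1 (h1.trans hn))
  have hclose : ∀ d ∈ D n, ∀ ε, (∀ x, |φ x - d x| < ε) → ∀ μ : PointMeasure,
      |∫ x, φ x ∂μ.toMeasure - ∫ x, d x ∂μ.toMeasure| ≤ ε * ∫ x, χ n x ∂μ.toMeasure := by
    intro d hd ε hε μ
    rw [← integral_sub (integrable φ μ) (integrable d μ), ← integral_const_mul]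
    refine (abs_integral_le_integral_abs).trans
      (integral_mono ((integrable φ μ).sub (integrable d μ)).abs ((integrable (χ n) μ).const_mul _)
        fun x => ?_)
    by_cases hx : x ∈ Icc (-n : ℝ) n
    · simpa [hχ1 n x hx] using (hε x).le
    · have := (abs_nonneg _).trans_lt (hε x)
      simpa [hφ0 x hx, hD0 n d hd x hx] using mul_nonneg this.le (hχ0 n x)
  refine @continuous_iff_continuousAt _ _ τ _ _ |>.2 fun μ₀ => ?_
  refine Metric.tendsto_nhds.2 fun ε hε => ?_
  set c := ∫ x, χ n x ∂μ₀.toMeasure + 1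
  have hc : 0 < c := add_pos_of_nonneg_of_pos (integral_nonneg (hχ0 n)) one_pos
  obtain ⟨d, hd, hφd⟩ := hD n φ hφ0 (ε / (4 * c)) (by positivity)
  have e1 := ((hcont (χ n) (.inr ⟨n, rfl⟩)).tendsto μ₀).eventually
    (gt_mem_nhds (lt_add_one (∫ x, χ n x ∂μ₀.toMeasure)))
  have e2 := Metric.tendsto_nhds.1 ((hcont d (.inl (mem_iUnion.2 ⟨n, hd⟩))).tendsto μ₀) (ε / 2)
    (by positivity)
  filter_upwards [e1, e2] with μ h1 h2
  have h3 := hclose d hd _ hφd μ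
  have h4 := hclose d hd _ hφd μ₀
  have h5 : ε / (4 * c) * ∫ x, χ n x ∂μ.toMeasure < ε / 4 := by
    calc ε / (4 * c) * ∫ x, χ n x ∂μ.toMeasure < ε / (4 * c) * c := by gcongr
      _ = ε / 4 := by field_simp
  have h6 : ε / (4 * c) * ∫ x, χ n x ∂μ₀.toMeasure < ε / 4 := by
    calc ε / (4 * c) * ∫ x, χ n x ∂μ₀.toMeasure < ε / (4 * c) * c := by
          gcongr
          exact lt_add_one _
      _ = ε / 4 := by field_simp
  rw [Real.dist_eq] at h2 ⊢
  rw [abs_le] at h3 h4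
  rw [abs_lt] at h2 ⊢
  constructor <;> linarith

/-- Countability of the family of test functions is essential: the Borel σ-algebra of a countable
product of lines is the product σ-algebra, so measurability of each integral is enough. -/
lemma measurableSpace_eq_comap_toMeasure :
    instMeasurableSpace =
      MeasurableSpace.comap toMeasure inferInstance := by
  refine le_antisymm ?_ measurable_toMeasure.comap_le
  obtain ⟨D, hDc, hD⟩ := exists_countable_testFunctions
  have : Countable D := hDc
  let τ : TopologicalSpace PointMeasure := TopologicalSpace.induced
      (fun (μ : PointMeasure) (d : D) => ∫ x, d.1 x ∂μ.toMeasure) inferInstance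
  have hτ : τ ≤ instTopologicalSpace := by
    refine continuous_iff_le_induced.1 ?_
    exact @continuous_pi _ _ _ τ _ _ hD
  have h1 : instMeasurableSpace ≤ @borel PointMeasure τ :=
    MeasurableSpace.generateFrom_mono fun U hU => hτ U hU
  refine h1.trans ?_
  rw [borel_comap, ← BorelSpace.measurable_eq, ← measurable_iff_comap_le]
  have hm : Measurable[MeasurableSpace.comap toMeasure inferInstance] toMeasure :=
    comap_measurable _
  refine @measurable_pi_lambda _ _ _ (MeasurableSpace.comap toMeasure inferInstance) _ _ fun d => ?_
  simp_rw [fun μ => integral_eq_lintegral_pos_part_sub_lintegral_neg_part (integrable d.1 μ)]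
  exact (((Measure.measurable_lintegral d.1.continuous.measurable.ennreal_ofReal).comp
    hm).ennreal_toReal).sub (((Measure.measurable_lintegral
      d.1.continuous.neg.measurable.ennreal_ofReal).comp hm).ennreal_toReal)

lemma measurable_of_measurable_toMeasure {α : Type*} {m : MeasurableSpace α}
    {F : α → PointMeasure} (hF : Measurable fun x => (F x).toMeasure) : Measurable F := by
  rw [measurable_iff_comap_le, measurableSpace_eq_comap_toMeasure, MeasurableSpace.comap_comp]
  exact hF.comap_le

end PointMeasure

/-! ### Cluster exponents -/

/-- The exponent of the Laplace functional of the first `n` generations of offspring of a point of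
generation `m`, as a function of the position of that point. -/
noncomputable def clusterExponent (I : Set ℝ) (γ : ℕ → ℝ → ℝ≥0) (φ : ℝ → ℝ≥0∞) :
    ℕ → ℕ → ℝ → ℝ≥0∞
  | 0, _ => φ
  | n + 1, m => fun s => φ s + I.indicator
      (fun s => ∫⁻ t in Ioi s, hit (clusterExponent I γ φ n (m + 1) t) * γ (m + 1) (t - s)) s

section Cluster

variable {I : Set ℝ} {γ : ℕ → ℝ → ℝ≥0} {φ : ℝ → ℝ≥0∞}

lemma measurable_lintegral_Ioi_mul {F : ℝ → ℝ≥0∞} (hF : Measurable F) {g : ℝ → ℝ≥0}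
    (hg : Measurable g) : Measurable fun s => ∫⁻ t in Ioi s, F t * g (t - s) := by
  have : ∀ s : ℝ, ∫⁻ t in Ioi s, F t * g (t - s) =
      ∫⁻ t, {p : ℝ × ℝ | p.1 < p.2}.indicator (fun p => F p.2 * (g (p.2 - p.1) : ℝ≥0∞)) (s, t) := by
    intro s
    rw [← lintegral_indicator measurableSet_Ioi]
    rfl
  simp_rw [this]
  refine Measurable.lintegral_prod_right' (Measurable.indicator (by fun_prop) ?_)
  exact measurableSet_lt measurable_fst measurable_snd

lemma measurable_clusterExponent (hI : MeasurableSet I) (hγ : ∀ n, Measurable (γ (n + 1)))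
    (hφ : Measurable φ) (n m : ℕ) : Measurable (clusterExponent I γ φ n m) := by
  induction n generalizing m with
  | zero => exact hφ
  | succ n ih => exact hφ.add ((measurable_lintegral_Ioi_mul (ih (m + 1)).hit
      (hγ m)).indicator hI)

lemma clusterExponent_mono_left (n m : ℕ) :
    clusterExponent I γ φ n m ≤ clusterExponent I γ φ (n + 1) m := by
  induction n generalizing m with
  | zero => exact fun s => le_self_add
  | succ n ih =>
    intro s
    refine add_le_add le_rfl (indicator_le_indicator (lintegral_mono fun t => ?_))
    gcongr
    exact hit_mono (ih (m + 1) t)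

lemma clusterExponent_monotone (m : ℕ) : Monotone fun n => clusterExponent I γ φ n m :=
  monotone_nat_of_le_succ fun n => clusterExponent_mono_left n m

/-- Offspring lie to the right of their parents, so a cluster started in an upper set never leaves
it. This makes the exponent common to both processes. -/
lemma clusterExponent_eqOn (hI : IsUpperSet I) (n m : ℕ) :
    EqOn (clusterExponent I γ φ n m) (clusterExponent univ γ φ n m) I := by
  induction n generalizing m with
  | zero => exact fun s _ => rfl
  | succ n ih =>
    intro s hs
    simp only [clusterExponent, indicator_of_mem hs, indicator_univ]
    congr 1
    refine setLIntegral_congr_fun measurableSet_Ioi fun t ht => ?_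
    rw [ih (m + 1) (hI (mem_Ioi.1 ht).le hs)]

/-- The exponent of the Laplace functional of the cluster of an immigrant. -/
noncomputable def clusterLimit (γ : ℕ → ℝ → ℝ≥0) (φ : ℝ → ℝ≥0∞) (s : ℝ) : ℝ≥0∞ :=
  ⨆ n, clusterExponent univ γ φ n 0 s

lemma measurable_clusterLimit (hγ : ∀ n, Measurable (γ (n + 1))) (hφ : Measurable φ) :
    Measurable (clusterLimit γ φ) :=
  Measurable.iSup fun n => measurable_clusterExponent .univ hγ hφ n 0

lemma tendsto_clusterExponent (s : ℝ) :
    Tendsto (fun n => clusterExponent univ γ φ n 0 s) atTop (𝓝 (clusterLimit γ φ s)) :=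
  tendsto_atTop_iSup fun _ _ h => clusterExponent_monotone 0 h s

/-- Integrating an offspring intensity means adding up over the parents. -/
lemma lintegral_mul_hawkesIntensity_succ (hI : MeasurableSet I)
    (hγ : ∀ n, Measurable (γ (n + 1))) (γ₀ : ℝ≥0) (N : ℕ → PointMeasure) (n : ℕ)
    {F : ℝ → ℝ≥0∞} (hF : Measurable F) :
    ∫⁻ t, F t * hawkesIntensity I γ₀ γ N (n + 1) t =
      ∫⁻ s, I.indicator (fun s => ∫⁻ t in Ioi s, F t * γ (n + 1) (t - s)) s
        ∂(N n).toMeasure := by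
  let f : ℝ × ℝ → ℝ≥0∞ := {p : ℝ × ℝ | p.1 ∈ I ∧ p.1 < p.2}.indicator
    fun p => F p.2 * γ (n + 1) (p.2 - p.1)
  have hf : Measurable f := by
    have := hγ n
    refine Measurable.indicator (by fun_prop) ?_
    exact (measurable_fst hI).inter (measurableSet_lt measurable_fst measurable_snd)
  have h1 : ∀ t, F t * hawkesIntensity I γ₀ γ N (n + 1) t = ∫⁻ s, f (s, t) ∂(N n).toMeasure := by
    intro t
    have := hγ n
    simp only [hawkesIntensity]
    rw [← lintegral_const_mul _ (by fun_prop), ← lintegral_indicator (hI.inter measurableSet_Iio)]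
    rfl
  have h2 : ∀ s, I.indicator (fun s => ∫⁻ t in Ioi s, F t * γ (n + 1) (t - s)) s =
      ∫⁻ t, f (s, t) := by
    intro s
    by_cases hs : s ∈ I
    · rw [indicator_of_mem hs, ← lintegral_indicator measurableSet_Ioi]
      refine lintegral_congr fun t => ?_
      simp [f, indicator, hs]
    · simp [f, indicator, hs]
  simp_rw [h1, h2]
  exact (lintegral_lintegral_swap (μ := (N n).toMeasure) (ν := volume)
    (f := fun s t => f (s, t)) hf.aemeasurable).symm

lemma measurable_hawkesIntensity (hI : MeasurableSet I)
    (hγ : ∀ n, Measurable (γ (n + 1))) (γ₀ : ℝ≥0) (N : ℕ → PointMeasure) (n : ℕ) :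
    Measurable (hawkesIntensity I γ₀ γ N n) := by
  cases n with
  | zero => exact measurable_const.indicator hI
  | succ n =>
    have : ∀ t, hawkesIntensity I γ₀ γ N (n + 1) t = ∫⁻ s,
        {p : ℝ × ℝ | p.2 ∈ I ∧ p.2 < p.1}.indicator
          (fun p => (γ (n + 1) (p.1 - p.2) : ℝ≥0∞)) (t, s) ∂(N n).toMeasure := by
      intro t
      simp only [hawkesIntensity]
      rw [← lintegral_indicator (hI.inter measurableSet_Iio)]
      rfl
    rw [funext this]
    have := hγ n
    refine Measurable.lintegral_prod_right' (Measurable.indicator (by fun_prop) ?_)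
    exact (measurable_snd hI).inter (measurableSet_lt measurable_snd measurable_fst)

end Cluster

/-! ### The Laplace functional of a Hawkes process -/

section Laplace

variable {Ω : Type*} {N : ℕ → Ω → PointMeasure} {φ χ : ℝ → ℝ≥0∞}

lemma pastGenerations_le {mΩ : MeasurableSpace Ω} (hN : ∀ n, Measurable (N n)) (n : ℕ) : pastGenerations N n ≤ mΩ :=
  iSup_le fun j => (hN j).comap_le

lemma pastGenerations_mono : Monotone (pastGenerations N) := fun _ m h =>
  iSup_le fun j => le_iSup_of_le (⟨j, j.2.trans_le h⟩ : Fin m) le_rfl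

lemma measurable_pastGenerations (n : ℕ) : Measurable[pastGenerations N (n + 1)] (N n) := by
  rw [measurable_iff_comap_le]
  exact le_iSup_of_le (Fin.last n) le_rfl

lemma measurable_lintegral_generation (n : ℕ) (hφ : Measurable φ) :
    Measurable[pastGenerations N (n + 1)] fun ω => ∫⁻ x, φ x ∂(N n ω).toMeasure :=
  ((Measure.measurable_lintegral hφ).comp PointMeasure.measurable_toMeasure).comp
    (measurable_pastGenerations n)

namespace IsHawkesGenerations

variable [MeasurableSpace Ω] {P : Measure Ω} [IsProbabilityMeasure P]
  {I : Set ℝ} {γ₀ : ℝ≥0} {γ : ℕ → ℝ → ℝ≥0}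

lemma lintegral_mul_expNeg (hN : IsHawkesGenerations P I γ₀ γ N) (hI : MeasurableSet I)
    (hγ : ∀ n, Measurable (γ (n + 1))) (n : ℕ) {Z : Ω → ℝ≥0∞}
    (hZ : Measurable[pastGenerations N n] Z) (hZ1 : ∀ ω, Z ω ≤ 1) (hφ : Measurable φ) :
    ∫⁻ ω, Z ω * expNeg (∫⁻ x, φ x ∂(N n ω).toMeasure) ∂P = ∫⁻ ω, Z ω * expNeg
      (∫⁻ t, hit (φ t) * hawkesIntensity I γ₀ γ (fun j => N j ω) n t) ∂P := by
  refine (hN.condPoisson n).lintegral_expNeg (pastGenerations_le hN.measurable n)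
    (fun B hB => (PointMeasure.measurable_apply hB).comp (hN.measurable n))
    (fun ω => measurable_hawkesIntensity hI hγ γ₀ _ n) (fun ψ hψ => ?_) hZ hZ1 hφ
  cases n with
  | zero => simp only [hawkesIntensity, measurable_const]
  | succ n =>
    simp_rw [lintegral_mul_hawkesIntensity_succ hI hγ γ₀ _ n hψ]
    exact ((Measure.measurable_lintegral ((measurable_lintegral_Ioi_mul hψ (hγ n)).indicator
      hI)).comp PointMeasure.measurable_toMeasure).comp (hN.measurable n)

/-- The induction hypothesis collapses generations `m + 1, …` to an exponent on `N (m + 1)`;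
integrating that generation out given its past yields an integral against its intensity, which is a
sum over the points of `N m`. The factor `Z` is general so that it can absorb the contribution of `N
m` itself. -/
lemma lintegral_mul_expNeg_sum (hN : IsHawkesGenerations P I γ₀ γ N) (hI : MeasurableSet I)
    (hγ : ∀ n, Measurable (γ (n + 1))) (hφ : Measurable φ) (n m : ℕ) {Z : Ω → ℝ≥0∞}
    (hZ : Measurable[pastGenerations N (m + 1)] Z) (hZ1 : ∀ ω, Z ω ≤ 1) :
    ∫⁻ ω, Z ω * expNeg (∑ j ∈ Finset.range (n + 1), ∫⁻ x, φ x ∂(N (m + j) ω).toMeasure) ∂P =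
      ∫⁻ ω, Z ω * expNeg (∫⁻ x, clusterExponent I γ φ n m x ∂(N m ω).toMeasure) ∂P := by
  induction n generalizing m Z with
  | zero => simp [clusterExponent]
  | succ n ih =>
    set Z' : Ω → ℝ≥0∞ := fun ω => Z ω * expNeg (∫⁻ x, φ x ∂(N m ω).toMeasure)
    have hZ' : Measurable[pastGenerations N (m + 1)] Z' :=
      hZ.mul (measurable_expNeg.comp (measurable_lintegral_generation m hφ))
    have hZ1' : ∀ ω, Z' ω ≤ 1 := fun ω => mul_le_one' (hZ1 ω) (expNeg_le_one _)
    have hV := measurable_clusterExponent hI hγ hφ n (m + 1)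
    calc _ = ∫⁻ ω, Z' ω * expNeg
          (∑ j ∈ Finset.range (n + 1), ∫⁻ x, φ x ∂(N (m + 1 + j) ω).toMeasure) ∂P := by
          refine lintegral_congr fun ω => ?_
          rw [Finset.sum_range_succ', expNeg_add, add_zero]
          simp only [Z', add_assoc, add_comm 1]
          ring
      _ = _ := by
          rw [ih (m + 1) (hZ'.mono (pastGenerations_mono (Nat.le_succ _)) le_rfl) hZ1',
            hN.lintegral_mul_expNeg hI hγ (m + 1) hZ' hZ1' hV]
          refine lintegral_congr fun ω => ?_
          rw [lintegral_mul_hawkesIntensity_succ hI hγ γ₀ _ m hV.hit]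
          simp only [Z', mul_assoc]
          rw [← expNeg_add, ← lintegral_add_left hφ]
          rfl

/-- The Laplace functional of a Hawkes process, jointly with its immigrants. -/
theorem lintegral_expNeg (hN : IsHawkesGenerations P I γ₀ γ N) (hI : MeasurableSet I)
    (hI' : IsUpperSet I) (hγ : ∀ n, Measurable (γ (n + 1))) (hχ : Measurable χ)
    (hφ : Measurable φ) :
    ∫⁻ ω, expNeg (∫⁻ x, χ x ∂(N 0 ω).toMeasure + ∑' j, ∫⁻ x, φ x ∂(N j ω).toMeasure) ∂P =
      expNeg (γ₀ * ∫⁻ t in I, hit (χ t + clusterLimit γ φ t)) := by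
  have hm : ∀ j (ψ : ℝ → ℝ≥0∞), Measurable ψ → Measurable fun ω => ∫⁻ x, ψ x ∂(N j ω).toMeasure :=
    fun j ψ hψ => ((Measure.measurable_lintegral hψ).comp PointMeasure.measurable_toMeasure).comp
      (hN.measurable j)
  have hV := fun n => measurable_clusterExponent hI hγ hφ n 0
  have hfin : ∀ n, ∫⁻ ω, expNeg (∫⁻ x, χ x ∂(N 0 ω).toMeasure +
      ∑ j ∈ Finset.range (n + 1), ∫⁻ x, φ x ∂(N j ω).toMeasure) ∂P =
        expNeg (γ₀ * ∫⁻ t in I, hit (χ t + clusterExponent univ γ φ n 0 t)) := by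
    intro n
    -- The immigrants' extra test function `χ` enters as the weight `Z`; afterwards only generation
    -- `0`, with its deterministic intensity, remains.
    have h1 := hN.lintegral_mul_expNeg_sum hI hγ hφ n 0
      (measurable_expNeg.comp (measurable_lintegral_generation 0 hχ)) fun ω => expNeg_le_one _
    have h2 := hN.lintegral_mul_expNeg hI hγ 0 (Z := fun _ => 1) measurable_const (by simp)
      (hχ.add (hV n))
    simp only [Function.comp_apply, ← expNeg_add, zero_add, one_mul] at h1 h2
    rw [h1]
    simp_rw [← lintegral_add_left hχ]
    refine h2.trans ?_
    simp only [hawkesIntensity, lintegral_const, measure_univ, mul_one]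
    congr 1
    have := measurable_clusterExponent .univ hγ hφ n 0
    rw [← lintegral_const_mul _ (by fun_prop), ← lintegral_indicator hI]
    refine lintegral_congr fun t => ?_
    by_cases ht : t ∈ I
    · simp [ht, clusterExponent_eqOn hI' n 0 ht, mul_comm]
    · simp [ht]
  have hl : Tendsto (fun n => ∫⁻ ω, expNeg (∫⁻ x, χ x ∂(N 0 ω).toMeasure +
      ∑ j ∈ Finset.range (n + 1), ∫⁻ x, φ x ∂(N j ω).toMeasure) ∂P) atTop
      (𝓝 (∫⁻ ω, expNeg (∫⁻ x, χ x ∂(N 0 ω).toMeasure +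
        ∑' j, ∫⁻ x, φ x ∂(N j ω).toMeasure) ∂P)) := by
    refine tendsto_lintegral_of_dominated_convergence (fun _ => 1)
      (fun n => measurable_expNeg.comp ((hm 0 χ hχ).add
        (Finset.measurable_fun_sum _ fun j _ => hm j φ hφ)))
      (fun n => .of_forall fun ω => expNeg_le_one _) (by simp) (.of_forall fun ω => ?_)
    refine (continuous_expNeg.tendsto _).comp (tendsto_const_nhds.add ?_)
    exact ENNReal.summable.hasSum.tendsto_sum_nat.comp (tendsto_add_atTop_nat 1)
  have hr : Tendsto (fun n => expNeg (γ₀ * ∫⁻ t in I, hit (χ t + clusterExponent univ γ φ n 0 t)))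
      atTop (𝓝 (expNeg (γ₀ * ∫⁻ t in I, hit (χ t + clusterLimit γ φ t)))) := by
    refine (continuous_expNeg.tendsto _).comp
      (ENNReal.Tendsto.const_mul ?_ (.inr ENNReal.coe_ne_top))
    refine lintegral_tendsto_of_tendsto_of_monotone
      (fun n => (measurable_hit.comp (hχ.add
        (measurable_clusterExponent .univ hγ hφ n 0))).aemeasurable)
      (.of_forall fun t n k h => hit_mono ?_) (.of_forall fun t => ?_)
    · gcongr
      exact clusterExponent_monotone 0 h t
    · exact (continuous_hit.tendsto _).comp (tendsto_const_nhds.add (tendsto_clusterExponent t))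
  exact tendsto_nhds_unique (hl.congr hfin) hr

end IsHawkesGenerations

end Laplace

/-! ### Integral bounds for the probability that a cluster hits a set -/

section Bounds

lemma setLIntegral_Ioi_sub (F : ℝ → ℝ≥0∞) (s : ℝ) (g : ℝ → ℝ≥0) :
    ∫⁻ t in Ioi s, F t * g (t - s) = ∫⁻ x in Ioi 0, F (x + s) * g x := by
  rw [← lintegral_indicator measurableSet_Ioi, ← lintegral_indicator measurableSet_Ioi,
    ← lintegral_add_right_eq_self _ s]
  refine lintegral_congr fun x => ?_
  simp [indicator]

lemma setLIntegral_setLIntegral_Ioi {F : ℝ → ℝ≥0∞} (hF : Measurable F) {g : ℝ → ℝ≥0}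
    (hg : Measurable g) {J : Set ℝ} :
    ∫⁻ s in J, ∫⁻ t in Ioi s, F t * g (t - s) =
      ∫⁻ x in Ioi 0, (∫⁻ s in J, F (x + s)) * g x := by
  rw [lintegral_congr fun s => setLIntegral_Ioi_sub F s g, lintegral_lintegral_swap (by fun_prop)]
  refine lintegral_congr fun x => ?_
  rw [lintegral_mul_const _ (by fun_prop)]

lemma lintegral_setLIntegral_Ioi {F : ℝ → ℝ≥0∞} (hF : Measurable F) {g : ℝ → ℝ≥0}
    (hg : Measurable g) :
    ∫⁻ s, ∫⁻ t in Ioi s, F t * g (t - s) = (∫⁻ t, F t) * ∫⁻ x in Ioi 0, (g x : ℝ≥0∞) := by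
  have := setLIntegral_setLIntegral_Ioi hF hg (J := univ)
  simp only [setLIntegral_univ, lintegral_add_left_eq_self F] at this
  rw [this, lintegral_const_mul _ (by fun_prop)]

/-- A child born with delay `x` crosses the origin exactly for parents in `[-x, 0)`, an interval of
length `x`. This is the source of the first-moment condition. -/
lemma setLIntegral_Iio_setLIntegral_Ioi {g : ℝ → ℝ≥0} (hg : Measurable g) :
    ∫⁻ s in Iio 0, ∫⁻ t in Ioi s, (Ici 0).indicator 1 t * (g (t - s) : ℝ≥0∞) =
      ∫⁻ x in Ioi 0, ENNReal.ofReal x * g x := by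
  rw [setLIntegral_setLIntegral_Ioi (measurable_one.indicator measurableSet_Ici) hg]
  refine setLIntegral_congr_fun measurableSet_Ioi fun x hx => ?_
  congr 1
  have : (fun s => (Ici (0 : ℝ)).indicator (1 : ℝ → ℝ≥0∞) (x + s)) =
      (Ici (-x)).indicator 1 := by
    ext s
    simp only [indicator, mem_Ici, Pi.one_apply]
    congr 1
    simp [neg_le_iff_add_nonneg']
  rw [this, lintegral_indicator_one measurableSet_Ici, Measure.restrict_apply measurableSet_Ici,
    Ici_inter_Iio, Real.volume_Ico]
  simp

/-- `A / (1 - ρ)` is the fixed point of `x ↦ A + x ρ`, the form in which the geometric series closes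
the inductions below. -/
lemma one_sub_mul_inv_add {ρ : ℝ≥0∞} (hρ : ρ < 1) (A : ℝ≥0∞) :
    A + A * (1 - ρ)⁻¹ * ρ = A * (1 - ρ)⁻¹ := by
  have h0 : 1 - ρ ≠ 0 := (tsub_pos_of_lt hρ).ne'
  have h1 : 1 - ρ ≠ ∞ := ne_top_of_le_ne_top (by simp) tsub_le_self
  calc A + A * (1 - ρ)⁻¹ * ρ = A * (1 - ρ)⁻¹ * ((1 - ρ) + ρ) := by
        rw [mul_add, mul_assoc A _ (1 - ρ), ENNReal.inv_mul_cancel h0 h1, mul_one]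
    _ = _ := by rw [tsub_add_cancel_of_le hρ.le, mul_one]

variable {γ : ℕ → ℝ → ℝ≥0} {φ : ℝ → ℝ≥0∞}

/-- A cluster hits through its root or through the cluster of a child. Integrated over the position
of the root, the second term is at most `ρ` times the bound for one generation fewer; the bound must
be uniform in `m` because the children belong to generation `m + 1`. -/
lemma lintegral_hit_clusterExponent_le (hγ : ∀ n, Measurable (γ (n + 1)))
    (hρ : (⨆ n : ℕ, ∫⁻ t in Ioi (0 : ℝ), (γ (n + 1) t : ℝ≥0∞)) < 1) (hφ : Measurable φ)
    (n m : ℕ) :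
    ∫⁻ s, hit (clusterExponent univ γ φ n m s) ≤ (∫⁻ s, hit (φ s)) *
      (1 - ⨆ n : ℕ, ∫⁻ t in Ioi (0 : ℝ), (γ (n + 1) t : ℝ≥0∞))⁻¹ := by
  rw [← one_sub_mul_inv_add hρ]
  induction n generalizing m with
  | zero => exact le_self_add
  | succ n ih =>
    have hV := measurable_clusterExponent .univ hγ hφ n (m + 1)
    calc ∫⁻ s, hit (clusterExponent univ γ φ (n + 1) m s)
        ≤ ∫⁻ s, (hit (φ s) + ∫⁻ t in Ioi s,
            hit (clusterExponent univ γ φ n (m + 1) t) * γ (m + 1) (t - s)) :=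
          lintegral_mono fun s => by
            simp only [clusterExponent, indicator_univ]
            exact hit_add_le _ _
      _ = (∫⁻ s, hit (φ s)) + (∫⁻ t, hit (clusterExponent univ γ φ n (m + 1) t)) *
            ∫⁻ x in Ioi 0, (γ (m + 1) x : ℝ≥0∞) := by
          rw [lintegral_add_left hφ.hit, lintegral_setLIntegral_Ioi hV.hit (hγ m)]
      _ ≤ _ := by
          gcongr
          · rw [← one_sub_mul_inv_add hρ]
            exact ih (m + 1)
          · exact le_iSup (fun n : ℕ => ∫⁻ t in Ioi (0 : ℝ), (γ (n + 1) t : ℝ≥0∞)) m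

/-- A negative point reaches `[0, ∞)` either by a child that crosses the origin, at total cost at
most `η`, or by the cluster of a child that is still negative, which costs a factor `ρ`. Bounding
`hit` by `1` on `[0, ∞)` allows `φ = ∞` there. -/
lemma setLIntegral_Iio_hit_clusterExponent_le (hγ : ∀ n, Measurable (γ (n + 1)))
    (hρ : (⨆ n : ℕ, ∫⁻ t in Ioi (0 : ℝ), (γ (n + 1) t : ℝ≥0∞)) < 1) (hφ : Measurable φ)
    (hφ0 : ∀ s < 0, φ s = 0) (n m : ℕ) :
    ∫⁻ s in Iio 0, hit (clusterExponent univ γ φ n m s) ≤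
      (⨆ n : ℕ, ∫⁻ t in Ioi (0 : ℝ), ENNReal.ofReal t * (γ (n + 1) t : ℝ≥0∞)) *
        (1 - ⨆ n : ℕ, ∫⁻ t in Ioi (0 : ℝ), (γ (n + 1) t : ℝ≥0∞))⁻¹ := by
  rw [← one_sub_mul_inv_add hρ]
  induction n generalizing m with
  | zero =>
    rw [setLIntegral_congr_fun (g := fun _ => 0) measurableSet_Iio fun s hs => ?_]
    · simp
    · simp [clusterExponent, hφ0 s hs, hit_zero]
  | succ n ih =>
    set V := clusterExponent univ γ φ n (m + 1)
    have hV : Measurable V := measurable_clusterExponent .univ hγ hφ n (m + 1)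
    have hVi : Measurable ((Iio 0).indicator fun t => hit (V t)) := hV.hit.indicator measurableSet_Iio
    calc ∫⁻ s in Iio 0, hit (clusterExponent univ γ φ (n + 1) m s)
        ≤ ∫⁻ s in Iio 0, ∫⁻ t in Ioi s, hit (V t) * γ (m + 1) (t - s) := by
          refine setLIntegral_mono' measurableSet_Iio fun s hs => ?_
          simp only [clusterExponent, indicator_univ, hφ0 s hs, zero_add]
          exact hit_le_self _
      _ ≤ ∫⁻ s in Iio 0, ((∫⁻ t in Ioi s, (Ici 0).indicator 1 t * (γ (m + 1) (t - s) : ℝ≥0∞)) +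
            ∫⁻ t in Ioi s, (Iio 0).indicator (fun t => hit (V t)) t * γ (m + 1) (t - s)) := by
          refine lintegral_mono fun s => ?_
          have := hγ m
          have h1 : Measurable fun t => (Ici 0).indicator 1 t * (γ (m + 1) (t - s) : ℝ≥0∞) :=
            (measurable_one.indicator measurableSet_Ici).mul (by fun_prop)
          rw [← lintegral_add_left h1]
          refine lintegral_mono fun t => ?_
          simp only
          rw [← add_mul]
          gcongr
          by_cases ht : t < 0
          · simp [ht]
          · simpa [ht, indicator, not_lt.1 ht] using hit_le_one _
      _ ≤ (∫⁻ x in Ioi 0, ENNReal.ofReal x * γ (m + 1) x) +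
            (∫⁻ t in Iio 0, hit (V t)) * ∫⁻ x in Ioi 0, (γ (m + 1) x : ℝ≥0∞) := by
          rw [lintegral_add_left (measurable_lintegral_Ioi_mul
            (measurable_one.indicator measurableSet_Ici) (hγ m)),
            setLIntegral_Iio_setLIntegral_Ioi (hγ m)]
          gcongr
          refine (setLIntegral_le_lintegral _ _).trans_eq ?_
          rw [lintegral_setLIntegral_Ioi hVi (hγ m), lintegral_indicator measurableSet_Iio]
      _ ≤ _ := by
          gcongr
          · exact le_iSup (fun n : ℕ => ∫⁻ t in Ioi (0 : ℝ),
              ENNReal.ofReal t * (γ (n + 1) t : ℝ≥0∞)) m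
          · rw [← one_sub_mul_inv_add hρ]
            exact ih (m + 1)
          · exact le_iSup (fun n : ℕ => ∫⁻ t in Ioi (0 : ℝ), (γ (n + 1) t : ℝ≥0∞)) m

lemma setLIntegral_hit_clusterLimit_le (hγ : ∀ n, Measurable (γ (n + 1))) (hφ : Measurable φ)
    {J : Set ℝ} {C : ℝ≥0∞} (h : ∀ n, ∫⁻ s in J, hit (clusterExponent univ γ φ n 0 s) ≤ C) :
    ∫⁻ s in J, hit (clusterLimit γ φ s) ≤ C :=
  le_of_tendsto' (lintegral_tendsto_of_tendsto_of_monotone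
    (fun n => (measurable_clusterExponent .univ hγ hφ n 0).hit.aemeasurable)
    (.of_forall fun s _ _ h => hit_mono (clusterExponent_monotone 0 h s))
    (.of_forall fun s => (continuous_hit.tendsto _).comp (tendsto_clusterExponent s))) h

lemma lintegral_hit_clusterLimit_le (hγ : ∀ n, Measurable (γ (n + 1)))
    (hρ : (⨆ n : ℕ, ∫⁻ t in Ioi (0 : ℝ), (γ (n + 1) t : ℝ≥0∞)) < 1) (hφ : Measurable φ) :
    ∫⁻ s, hit (clusterLimit γ φ s) ≤ (∫⁻ s, hit (φ s)) *
      (1 - ⨆ n : ℕ, ∫⁻ t in Ioi (0 : ℝ), (γ (n + 1) t : ℝ≥0∞))⁻¹ := by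
  rw [← setLIntegral_univ]
  refine setLIntegral_hit_clusterLimit_le hγ hφ fun n => ?_
  rw [setLIntegral_univ]
  exact lintegral_hit_clusterExponent_le hγ hρ hφ n 0

lemma clusterExponent_comp_sub (a : ℝ) (n m : ℕ) (s : ℝ) :
    clusterExponent univ γ (fun x => φ (x - a)) n m s = clusterExponent univ γ φ n m (s - a) := by
  induction n generalizing m s with
  | zero => rfl
  | succ n ih =>
    simp only [clusterExponent, indicator_univ, setLIntegral_Ioi_sub, ih, add_sub_assoc]

lemma clusterLimit_comp_sub (a s : ℝ) :
    clusterLimit γ (fun x => φ (x - a)) s = clusterLimit γ φ (s - a) := by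
  simp only [clusterLimit, clusterExponent_comp_sub]

lemma clusterExponent_mono_right {ψ : ℝ → ℝ≥0∞} (h : φ ≤ ψ) (n m : ℕ) :
    clusterExponent univ γ φ n m ≤ clusterExponent univ γ ψ n m := by
  induction n generalizing m with
  | zero => exact h
  | succ n ih =>
    intro s
    refine add_le_add (h s) (indicator_le_indicator (lintegral_mono fun t => ?_))
    gcongr
    exact hit_mono (ih (m + 1) t)

lemma clusterLimit_mono {ψ : ℝ → ℝ≥0∞} (h : φ ≤ ψ) : clusterLimit γ φ ≤ clusterLimit γ ψ :=
  fun s => iSup_mono fun n => clusterExponent_mono_right h n 0 s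

/-- Points to the right of the support of `φ` have all their descendants there too. -/
lemma clusterExponent_eq_zero {b : ℝ} (h : ∀ s > b, φ s = 0) (n m : ℕ) {s : ℝ} (hs : b < s) :
    clusterExponent univ γ φ n m s = 0 := by
  induction n generalizing m s with
  | zero => exact h s hs
  | succ n ih =>
    simp only [clusterExponent, indicator_univ, h s hs, zero_add]
    rw [setLIntegral_congr_fun (g := fun _ => 0) measurableSet_Ioi fun t ht => ?_]
    · simp
    · simp [ih (m + 1) (hs.trans ht), hit_zero]

lemma clusterLimit_eq_zero {b : ℝ} (h : ∀ s > b, φ s = 0) {s : ℝ} (hs : b < s) :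
    clusterLimit γ φ s = 0 := by
  simp [clusterLimit, clusterExponent_eq_zero h _ _ hs]

lemma tendsto_setLIntegral_Iic_neg {f : ℝ → ℝ≥0∞} (hf : Measurable f)
    (h : ∫⁻ s in Iio 0, f s ≠ ∞) :
    Tendsto (fun s : ℝ => ∫⁻ u in Iic (-s), f u) atTop (𝓝 0) := by
  simp_rw [← lintegral_indicator measurableSet_Iic]
  rw [← lintegral_indicator measurableSet_Iio] at h
  rw [← lintegral_zero (μ := (volume : Measure ℝ))]
  refine tendsto_lintegral_filter_of_dominated_convergence ((Iio 0).indicator f)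
    (.of_forall fun s => hf.indicator measurableSet_Iic) ?_ h (.of_forall fun u => ?_)
  · filter_upwards [eventually_gt_atTop 0] with s hs
    refine .of_forall fun u => indicator_le_indicator_of_subset (fun v hv => ?_)
      (fun _ => zero_le) u
    exact (mem_Iic.1 hv).trans_lt (by linarith)
  · refine tendsto_const_nhds.congr' ?_
    filter_upwards [eventually_gt_atTop (-u)] with s hs
    rw [indicator_of_notMem]
    simp only [mem_Iic, not_le]
    linarith

end Bounds

/-! ### Local finiteness -/

section LocallyFinite

variable {Ω : Type*} [MeasurableSpace Ω] {P : Measure Ω} [IsProbabilityMeasure P]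
  {I : Set ℝ} {γ₀ : ℝ≥0} {γ : ℕ → ℝ → ℝ≥0} {N : ℕ → Ω → PointMeasure}

/-- For the total count `T` of `B`, `1 - c K ≤ E exp(-c T) ≤ P(T < ∞)` for every `c > 0`, because
`exp(-∞) = 0`; now let `c → 0`. -/
lemma IsHawkesGenerations.ae_tsum_apply_ne_top (hN : IsHawkesGenerations P I γ₀ γ N)
    (hI : MeasurableSet I) (hI' : IsUpperSet I) (hγ : ∀ n, Measurable (γ (n + 1)))
    (hρ : (⨆ n : ℕ, ∫⁻ t in Ioi (0 : ℝ), (γ (n + 1) t : ℝ≥0∞)) < 1)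
    {B : Set ℝ} (hB : MeasurableSet B) (hb : volume B ≠ ∞) :
    ∀ᵐ ω ∂P, ∑' j, (N j ω).toMeasure B ≠ ∞ := by
  set ρ := ⨆ n : ℕ, ∫⁻ t in Ioi (0 : ℝ), (γ (n + 1) t : ℝ≥0∞)
  have hm : Measurable fun ω => ∑' j, (N j ω).toMeasure B :=
    Measurable.tsum fun j => (PointMeasure.measurable_apply hB).comp (hN.measurable j)
  have hA : MeasurableSet {ω | ∑' j, (N j ω).toMeasure B ≠ ∞} :=
    (hm (measurableSet_singleton _)).compl
  set K : ℝ≥0∞ := γ₀ * (volume B * (1 - ρ)⁻¹)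
  have hK : K ≠ ∞ := ENNReal.mul_ne_top ENNReal.coe_ne_top (ENNReal.mul_ne_top hb
    (ENNReal.inv_ne_top.2 (tsub_pos_of_lt hρ).ne'))
  have key : ∀ c : ℝ≥0, 0 < c → 1 - c * K ≤ P {ω | ∑' j, (N j ω).toMeasure B ≠ ∞} := by
    intro c hc
    have hφ : Measurable (B.indicator fun _ => (c : ℝ≥0∞)) := measurable_const.indicator hB
    have h1 := hN.lintegral_expNeg hI hI' hγ (χ := fun _ => 0) measurable_const hφ
    simp only [lintegral_zero, zero_add, lintegral_indicator_const hB, ENNReal.tsum_mul_left] at h1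
    calc 1 - c * K ≤ 1 - γ₀ * ∫⁻ t in I, hit (clusterLimit γ (B.indicator fun _ => ↑c) t) := by
          refine tsub_le_tsub_left ?_ 1
          simp only [K]
          rw [mul_left_comm]
          gcongr
          refine (setLIntegral_le_lintegral _ _).trans
            ((lintegral_hit_clusterLimit_le hγ hρ hφ).trans ?_)
          rw [← mul_assoc, ← lintegral_indicator_const hB]
          gcongr
          exact hit_le_self _
      _ ≤ _ := one_sub_le_expNeg _
      _ = _ := h1.symm
      _ ≤ ∫⁻ ω, {ω | ∑' j, (N j ω).toMeasure B ≠ ∞}.indicator 1 ω ∂P := by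
          refine lintegral_mono fun ω => ?_
          by_cases h : ∑' j, (N j ω).toMeasure B = ∞
          · rw [h, ENNReal.mul_top (by simpa using hc.ne'), expNeg_top]
            exact zero_le
          · rw [indicator_of_mem (by exact h)]
            exact expNeg_le_one _
      _ = _ := lintegral_indicator_one hA
  have hlim : Tendsto (fun c : ℝ≥0 => 1 - c * K) (𝓝[>] 0) (𝓝 1) := by
    have h0 : Tendsto (fun c : ℝ≥0 => (c : ℝ≥0∞) * K) (𝓝[>] 0) (𝓝 ((0 : ℝ≥0) * K)) :=
      ENNReal.Tendsto.mul_const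
        ((ENNReal.continuous_coe.tendsto 0).mono_left nhdsWithin_le_nhds) (.inr hK)
    simpa using ENNReal.Tendsto.sub (tendsto_const_nhds (x := (1 : ℝ≥0∞))) h0 (.inl (by simp))
  have h1 : 1 ≤ P {ω | ∑' j, (N j ω).toMeasure B ≠ ∞} :=
    le_of_tendsto hlim (eventually_nhdsWithin_of_forall fun c hc => key c hc)
  exact (prob_compl_eq_zero_iff hA).2 (le_antisymm prob_le_one h1)

end LocallyFinite

/-! ### Uniqueness of Laplace functionals and operations on point measures -/

namespace PointMeasure

section LaplaceFunctional

/-- The transforms `exp (-μ (a, b))` of the counts on rational intervals. -/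
noncomputable def countTransform (μ : PointMeasure) (i : ℚ × ℚ) : unitInterval :=
  ⟨(expNeg (μ.toMeasure (Ioo (i.1 : ℝ) i.2))).toReal, ENNReal.toReal_nonneg,
    ENNReal.toReal_le_of_le_ofReal zero_le_one (by simpa using expNeg_le_one _)⟩

lemma measurable_countTransform : Measurable countTransform :=
  measurable_pi_lambda _ fun _ =>
    ((measurable_apply measurableSet_Ioo).expNeg.ennreal_toReal).subtype_mk

/-- The counts are recovered from their transforms by a logarithm. This transfers questions about
laws to a compact metrisable cube. -/
lemma measurableSpace_le_comap_countTransform :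
    instMeasurableSpace ≤ MeasurableSpace.comap countTransform inferInstance := by
  have h : Measurable[MeasurableSpace.comap countTransform inferInstance, instMeasurableSpace]
      (id : PointMeasure → PointMeasure) := by
    refine measurable_of_measurable_toMeasure (measurable_toMeasure_of_Ioo fun a b => ?_)
    have h1 : ∀ x : ℝ≥0∞, x =
        (-(ENNReal.log (ENNReal.ofReal (expNeg x).toReal))).toENNReal := fun x => by
      rw [ENNReal.ofReal_toReal (expNeg_ne_top x), expNeg, EReal.log_exp, neg_neg,
        EReal.toENNReal_coe]
    have h2 : Measurable fun r : unitInterval =>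
        (-(ENNReal.log (ENNReal.ofReal (r : ℝ)))).toENNReal := by
      have := ENNReal.measurable_log
      fun_prop
    have h3 : Measurable[MeasurableSpace.comap countTransform inferInstance] fun μ =>
        countTransform μ (a, b) := 
      (measurable_pi_apply (X := fun _ : ℚ × ℚ => unitInterval) (a, b)).comp
        (comap_measurable countTransform)
    have h4 := h2.comp h3
    refine (congrArg _ (funext fun μ => ?_)).mp h4
    exact (h1 _).symm
  exact fun s hs => h hs

/-- The Laplace functional determines the law of a point process. -/
theorem ext_of_lintegral_expNeg {Q₁ Q₂ : Measure PointMeasure} [IsFiniteMeasure Q₁]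
    [IsFiniteMeasure Q₂] (h : ∀ φ : ℝ → ℝ≥0∞, Measurable φ →
      ∫⁻ μ, expNeg (∫⁻ x, φ x ∂μ.toMeasure) ∂Q₁ = ∫⁻ μ, expNeg (∫⁻ x, φ x ∂μ.toMeasure) ∂Q₂) :
    Q₁ = Q₂ := by
  have hK := measurable_countTransform
  let c : ℚ × ℚ → BoundedContinuousFunction (ℚ × ℚ → unitInterval) ℝ := fun i =>
    BoundedContinuousFunction.mkOfCompact ⟨fun x => x i, by fun_prop⟩
  -- By Stone–Weierstrass, the algebra generated by the coordinates separates finite measures on the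
  -- cube. It is spanned by monomials, and a monomial in the transforms is again `exp (-∫ φ dμ)`,
  -- with `φ` a sum of indicators.
  let A : StarSubalgebra ℝ (BoundedContinuousFunction (ℚ × ℚ → unitInterval) ℝ) :=
    { Algebra.adjoin ℝ (range c) with
      star_mem' := fun {a} ha => by
        have : star a = a := by ext; simp
        simpa only [this] using ha }
  have hmap : Q₁.map countTransform = Q₂.map countTransform := by
    refine ext_of_forall_mem_subalgebra_integral_eq_of_polish (𝕜 := ℝ) (A := A) ?_ ?_
    · intro x y hxy
      obtain ⟨i, hi⟩ := Function.ne_iff.1 hxy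
      refine ⟨_, ⟨(c i).toContinuousMap, ⟨c i, Algebra.subset_adjoin ⟨i, rfl⟩, rfl⟩, rfl⟩, ?_⟩
      exact fun h => hi (Subtype.ext h)
    · intro g hg
      have hg' : g ∈ Submodule.span ℝ (Submonoid.closure (range c) : Set _) := by
        rw [← Algebra.adjoin_eq_span]
        exact hg
      clear hg
      induction hg' using Submodule.span_induction with
      | mem g hg =>
        have : ∃ φ : ℝ → ℝ≥0∞, Measurable φ ∧
            ∀ μ, g (countTransform μ) = (expNeg (∫⁻ x, φ x ∂μ.toMeasure)).toReal := by
          induction hg using Submonoid.closure_induction with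
          | mem g hg =>
            obtain ⟨i, rfl⟩ := hg
            exact ⟨(Ioo (i.1 : ℝ) i.2).indicator 1, measurable_one.indicator measurableSet_Ioo,
              fun μ => by rw [lintegral_indicator_one measurableSet_Ioo]; rfl⟩
          | one => exact ⟨fun _ => 0, measurable_const, fun μ => by simp [expNeg_zero]⟩
          | mul f g _ _ hf hg =>
            obtain ⟨φ, hφ, hf⟩ := hf
            obtain ⟨ψ, hψ, hg⟩ := hg
            refine ⟨fun x => φ x + ψ x, hφ.add hψ, fun μ => ?_⟩
            rw [lintegral_add_left hφ, expNeg_add, ENNReal.toReal_mul, ← hf, ← hg]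
            rfl
        obtain ⟨φ, hφ, hg⟩ := this
        have hm : Measurable fun μ : PointMeasure => expNeg (∫⁻ x, φ x ∂μ.toMeasure) :=
          ((Measure.measurable_lintegral hφ).comp measurable_toMeasure).expNeg
        rw [integral_map hK.aemeasurable g.continuous.aestronglyMeasurable,
          integral_map hK.aemeasurable g.continuous.aestronglyMeasurable]
        simp_rw [hg]
        rw [integral_toReal hm.aemeasurable (.of_forall fun μ => (expNeg_ne_top _).lt_top),
          integral_toReal hm.aemeasurable (.of_forall fun μ => (expNeg_ne_top _).lt_top), h φ hφ]
      | zero => simp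
      | add f g _ _ hf hg =>
        simp only [BoundedContinuousFunction.coe_add, Pi.add_apply]
        rw [integral_add (f.integrable _) (g.integrable _),
          integral_add (f.integrable _) (g.integrable _), hf, hg]
      | smul r f _ hf =>
        simp only [BoundedContinuousFunction.coe_smul, integral_smul, hf]
  ext s hs
  obtain ⟨t, ht, rfl⟩ := measurableSpace_le_comap_countTransform s hs
  rw [← Measure.map_apply hK ht, ← Measure.map_apply hK ht, hmap]

end LaplaceFunctional

section Operations

lemma ext_toMeasure {μ ν : PointMeasure} (h : μ.toMeasure = ν.toMeasure) : μ = ν := by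
  cases μ
  cases ν
  congr

/-- The restriction of a point measure to a measurable set. -/
noncomputable def restrict (C : Set ℝ) (hC : MeasurableSet C) (μ : PointMeasure) :
    PointMeasure where
  toMeasure := μ.toMeasure.restrict C
  natValued := by
    intro B hB hb
    rw [Measure.restrict_apply hB]
    exact μ.natValued _ (hB.inter hC) (hb.subset inter_subset_left)

lemma measurable_restrict (C : Set ℝ) (hC : MeasurableSet C) : Measurable (restrict C hC) := by
  refine measurable_of_measurable_toMeasure (Measure.measurable_of_measurable_coe _ fun B hB => ?_)
  simp only [restrict, Measure.restrict_apply hB]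
  exact measurable_apply (hB.inter hC)

lemma restrict_restrict {C D : Set ℝ} (hC : MeasurableSet C) (hD : MeasurableSet D)
    (μ : PointMeasure) : (μ.restrict D hD).restrict C hC = μ.restrict (C ∩ D) (hC.inter hD) :=
  ext_toMeasure (Measure.restrict_restrict hC)

lemma measurable_shift (s : ℝ) : Measurable (shift s) :=
  measurable_of_measurable_toMeasure
    ((Measure.measurable_map _ (by fun_prop)).comp measurable_toMeasure)

/-- The superposition of two point measures. -/
noncomputable def add (μ ν : PointMeasure) : PointMeasure where
  toMeasure := μ.toMeasure + ν.toMeasure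
  natValued := by
    intro B hB hb
    obtain ⟨k, hk⟩ := μ.natValued B hB hb
    obtain ⟨l, hl⟩ := ν.natValued B hB hb
    exact ⟨k + l, by simp [hk, hl]⟩

lemma measurable_add : Measurable fun p : PointMeasure × PointMeasure => p.1.add p.2 := by
  refine measurable_of_measurable_toMeasure (Measure.measurable_of_measurable_coe _ fun B hB => ?_)
  simp only [add, Measure.coe_add, Pi.add_apply]
  exact ((measurable_apply hB).comp measurable_fst).add ((measurable_apply hB).comp measurable_snd)

/-- A finite sum of naturals has only finitely many nonzero terms, so local finiteness alone makes a
superposition integer-valued. -/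
lemma exists_nat_eq_tsum {f : ℕ → ℝ≥0∞} (hf : ∀ n, ∃ k : ℕ, f n = k)
    (h : ∑' n, f n ≠ ∞) : ∃ k : ℕ, ∑' n, f n = k := by
  choose k hk using hf
  have hfin := ENNReal.finite_const_le_of_tsum_ne_top h one_ne_zero
  refine ⟨∑ n ∈ hfin.toFinset, k n, ?_⟩
  rw [tsum_eq_sum (s := hfin.toFinset)]
  · simp [hk]
  · intro n hn
    have : ¬ 1 ≤ f n := by simpa using hn
    rw [hk] at this ⊢
    simpa [Nat.one_le_iff_ne_zero] using this

lemma isPointMeasure_sum_iff (N : ℕ → PointMeasure) :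
    IsPointMeasure (Measure.sum fun n => (N n).toMeasure) ↔
      ∀ k : ℕ, ∑' n, (N n).toMeasure (Ioo (-k : ℝ) k) ≠ ∞ := by
  constructor
  · intro h k
    obtain ⟨l, hl⟩ := h _ measurableSet_Ioo (Metric.isBounded_Ioo (-k : ℝ) k)
    rw [Measure.sum_apply _ measurableSet_Ioo] at hl
    simp [hl]
  · intro h B hB hb
    rw [Measure.sum_apply _ hB]
    refine exists_nat_eq_tsum (fun n => (N n).natValued B hB hb) ?_
    obtain ⟨R, hR⟩ := hb.subset_closedBall 0
    obtain ⟨k, hk⟩ := exists_nat_gt R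
    refine ne_top_of_le_ne_top (h k) (ENNReal.tsum_le_tsum fun n => measure_mono fun x hx => ?_)
    have := hR hx
    rw [mem_closedBall_zero_iff, Real.norm_eq_abs] at this
    exact abs_lt.1 (this.trans_lt hk)

lemma toMeasure_superposition {N : ℕ → PointMeasure}
    (h : IsPointMeasure (Measure.sum fun n => (N n).toMeasure)) :
    (superposition N).toMeasure = Measure.sum fun n => (N n).toMeasure := by
  rw [superposition, dif_pos h]

lemma measurable_superposition {Ω : Type*} [MeasurableSpace Ω] {N : ℕ → Ω → PointMeasure}
    (hN : ∀ n, Measurable (N n)) : Measurable fun ω => superposition fun n => N n ω := by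
  classical
  have hm : ∀ B, MeasurableSet B → Measurable fun ω => ∑' n, (N n ω).toMeasure B := fun B hB =>
    Measurable.tsum fun n => (measurable_apply hB).comp (hN n)
  set F : Set Ω := {ω | IsPointMeasure (Measure.sum fun n => (N n ω).toMeasure)}
  have hF : MeasurableSet F := by
    simp only [F, isPointMeasure_sum_iff, ofPred_forall]
    exact MeasurableSet.iInter fun k =>
      (hm _ measurableSet_Ioo (measurableSet_singleton ∞)).compl
  refine measurable_of_measurable_toMeasure (Measure.measurable_of_measurable_coe _ fun B hB => ?_)
  have : ∀ ω, (superposition fun n => N n ω).toMeasure B =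
      F.indicator (fun ω => ∑' n, (N n ω).toMeasure B) ω := by
    intro ω
    by_cases hω : ω ∈ F
    · rw [indicator_of_mem hω, toMeasure_superposition hω, Measure.sum_apply _ hB]
    · rw [indicator_of_notMem hω]
      simp only [superposition, dif_neg (show ¬IsPointMeasure _ from hω)]
      rfl
  simp_rw [this]
  exact (hm B hB).indicator hF

end Operations

end PointMeasure

lemma PointMeasure.lintegral_restrict_shift (μ : PointMeasure) (s : ℝ) {C : Set ℝ}
    (hC : MeasurableSet C) {φ : ℝ → ℝ≥0∞} (hφ : Measurable φ) :
    ∫⁻ x, φ x ∂((μ.shift s).restrict C hC).toMeasure =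
      ∫⁻ x, C.indicator φ (x - s) ∂μ.toMeasure := by
  simp only [PointMeasure.restrict, PointMeasure.shift]
  rw [← lintegral_indicator hC, lintegral_map (hφ.indicator hC) (by fun_prop)]

lemma PointMeasure.lintegral_restrict (μ : PointMeasure) {C : Set ℝ}
    (hC : MeasurableSet C) (φ : ℝ → ℝ≥0∞) :
    ∫⁻ x, φ x ∂(μ.restrict C hC).toMeasure = ∫⁻ x, C.indicator φ x ∂μ.toMeasure :=
  (lintegral_indicator hC φ).symm

lemma PointMeasure.measurable_expNeg_lintegral {φ : ℝ → ℝ≥0∞} (hφ : Measurable φ) :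
    Measurable fun μ : PointMeasure => expNeg (∫⁻ x, φ x ∂μ.toMeasure) :=
  ((Measure.measurable_lintegral hφ).comp measurable_toMeasure).expNeg

/-! ### Stationarity and comparison on a bounded window -/

section HawkesProcess

variable {Ω Ω' : Type*} [MeasurableSpace Ω] [MeasurableSpace Ω'] {P : Measure Ω}
  [IsProbabilityMeasure P] {P' : Measure Ω'} [IsProbabilityMeasure P'] {I : Set ℝ} {γ₀ : ℝ≥0}
  {γ : ℕ → ℝ → ℝ≥0} {N : ℕ → Ω → PointMeasure} {N' : ℕ → Ω' → PointMeasure}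

namespace IsHawkesGenerations

theorem ae_isPointMeasure (hN : IsHawkesGenerations P I γ₀ γ N)
    (hI : MeasurableSet I) (hI' : IsUpperSet I) (hγ : ∀ n, Measurable (γ (n + 1)))
    (hρ : (⨆ n : ℕ, ∫⁻ t in Ioi (0 : ℝ), (γ (n + 1) t : ℝ≥0∞)) < 1) :
    ∀ᵐ ω ∂P, IsPointMeasure (Measure.sum fun n => (N n ω).toMeasure) := by
  simp_rw [PointMeasure.isPointMeasure_sum_iff]
  exact ae_all_iff.2 fun k => hN.ae_tsum_apply_ne_top hI hI' hγ hρ measurableSet_Ioo (by simp)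

lemma lintegral_expNeg_superposition (hN : IsHawkesGenerations P I γ₀ γ N)
    (hI : MeasurableSet I) (hI' : IsUpperSet I) (hγ : ∀ n, Measurable (γ (n + 1)))
    (hρ : (⨆ n : ℕ, ∫⁻ t in Ioi (0 : ℝ), (γ (n + 1) t : ℝ≥0∞)) < 1)
    {χ φ : ℝ → ℝ≥0∞} (hχ : Measurable χ) (hφ : Measurable φ) :
    ∫⁻ ω, expNeg (∫⁻ x, χ x ∂(N 0 ω).toMeasure) *
        expNeg (∫⁻ x, φ x ∂(PointMeasure.superposition fun n => N n ω).toMeasure) ∂P =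
      expNeg (γ₀ * ∫⁻ t in I, hit (χ t + clusterLimit γ φ t)) := by
  rw [← hN.lintegral_expNeg hI hI' hγ hχ hφ]
  refine lintegral_congr_ae ?_
  filter_upwards [hN.ae_isPointMeasure hI hI' hγ hρ] with ω hω
  rw [PointMeasure.toMeasure_superposition hω, lintegral_sum_measure, expNeg_add]

lemma lintegral_expNeg_superposition' (hN : IsHawkesGenerations P I γ₀ γ N)
    (hI : MeasurableSet I) (hI' : IsUpperSet I) (hγ : ∀ n, Measurable (γ (n + 1)))
    (hρ : (⨆ n : ℕ, ∫⁻ t in Ioi (0 : ℝ), (γ (n + 1) t : ℝ≥0∞)) < 1)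
    {φ : ℝ → ℝ≥0∞} (hφ : Measurable φ) :
    ∫⁻ ω, expNeg (∫⁻ x, φ x ∂(PointMeasure.superposition fun n => N n ω).toMeasure) ∂P =
      expNeg (γ₀ * ∫⁻ t in I, hit (clusterLimit γ φ t)) := by
  simpa [expNeg_zero] using
    hN.lintegral_expNeg_superposition hI hI' hγ hρ (χ := fun _ => 0) measurable_const hφ

/-- The stationary Hawkes process is stationary. -/
lemma map_shift_restrict_eq (hN' : IsHawkesGenerations P' univ γ₀ γ N')
    (hγ : ∀ n, Measurable (γ (n + 1)))
    (hρ : (⨆ n : ℕ, ∫⁻ t in Ioi (0 : ℝ), (γ (n + 1) t : ℝ≥0∞)) < 1) (s : ℝ) {C : Set ℝ}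
    (hC : MeasurableSet C) :
    P'.map (fun ω => ((PointMeasure.superposition fun n => N' n ω).shift s).restrict C hC) =
      P'.map (fun ω => (PointMeasure.superposition fun n => N' n ω).restrict C hC) := by
  have hS := PointMeasure.measurable_superposition hN'.measurable
  have h1 : Measurable fun ω =>
      ((PointMeasure.superposition fun n => N' n ω).shift s).restrict C hC :=
    (PointMeasure.measurable_restrict C hC).comp ((PointMeasure.measurable_shift s).comp hS)
  have h2 : Measurable fun ω => (PointMeasure.superposition fun n => N' n ω).restrict C hC :=
    (PointMeasure.measurable_restrict C hC).comp hS
  refine PointMeasure.ext_of_lintegral_expNeg fun φ hφ => ?_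
  have hm := PointMeasure.measurable_expNeg_lintegral hφ
  have hφC := hφ.indicator hC
  rw [lintegral_map hm h1, lintegral_map hm h2]
  simp_rw [PointMeasure.lintegral_restrict_shift _ s hC hφ, PointMeasure.lintegral_restrict]
  rw [hN'.lintegral_expNeg_superposition' .univ isUpperSet_univ hγ hρ
    (φ := fun x => C.indicator φ (x - s)) (by fun_prop),
    hN'.lintegral_expNeg_superposition' .univ isUpperSet_univ hγ hρ hφC]
  simp only [clusterLimit_comp_sub, setLIntegral_univ]
  rw [lintegral_sub_right_eq_self (fun x => hit (clusterLimit γ (C.indicator φ) x))]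

/-- Seen from a time `s` on a bounded window, the stationary Hawkes process dominates in law the
process with empty history, up to the probability that the immigrants before time `0` have
descendants in the window. -/
theorem map_window_le (hN : IsHawkesGenerations P (Ioi 0) γ₀ γ N)
    (hN' : IsHawkesGenerations P' univ γ₀ γ N') (hγ : ∀ n, Measurable (γ (n + 1)))
    (hρ : (⨆ n : ℕ, ∫⁻ t in Ioi (0 : ℝ), (γ (n + 1) t : ℝ≥0∞)) < 1) (s b : ℝ)
    {A : Set PointMeasure} (hA : MeasurableSet A) :
    (1 - γ₀ * ∫⁻ u in Iic (-s), hit (clusterLimit γ ((Icc 0 b).indicator fun _ => ∞) u)) *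
      P.map (fun ω => ((PointMeasure.superposition fun n => N n ω).shift s).restrict (Icc 0 b)
        measurableSet_Icc) A ≤
      P'.map (fun ω => ((PointMeasure.superposition fun n => N' n ω).shift s).restrict (Icc 0 b)
        measurableSet_Icc) A := by
  set R : PointMeasure → PointMeasure := fun μ => (μ.shift s).restrict (Icc 0 b) measurableSet_Icc
  have hR : Measurable R := (PointMeasure.measurable_restrict _ measurableSet_Icc).comp
    (PointMeasure.measurable_shift s)
  have hRS : Measurable fun ω => R (PointMeasure.superposition fun n => N n ω) :=
    hR.comp (PointMeasure.measurable_superposition hN.measurable)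
  have hRS' : Measurable fun ω => R (PointMeasure.superposition fun n => N' n ω) :=
    hR.comp (PointMeasure.measurable_superposition hN'.measurable)
  -- With the value `∞`, the weight `w` is the indicator that the stationary process has no
  -- immigrant in `(0, s + b]`. Later immigrants cannot reach the window, so `QM` records the
  -- descendants of immigrants before time `0` on that event, whose probability is `c`.
  set χ : ℝ → ℝ≥0∞ := (Ioc 0 (s + b)).indicator fun _ => ∞
  have hχ : Measurable χ := measurable_const.indicator measurableSet_Ioc
  set w : Ω' → ℝ≥0∞ := fun ω => expNeg (∫⁻ x, χ x ∂(N' 0 ω).toMeasure)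
  have hw : Measurable w := (PointMeasure.measurable_expNeg_lintegral hχ).comp (hN'.measurable 0)
  have : IsFiniteMeasure (P'.withDensity w) := isFiniteMeasure_withDensity
    (ne_top_of_le_ne_top (by simp) (lintegral_mono fun ω => expNeg_le_one _))
  set Q := P.map (fun ω => R (PointMeasure.superposition fun n => N n ω))
  set Q' := P'.map (fun ω => R (PointMeasure.superposition fun n => N' n ω))
  set QM := (P'.withDensity w).map (fun ω => R (PointMeasure.superposition fun n => N' n ω))
  set c := expNeg (γ₀ * ENNReal.ofReal (s + b))
  have hc : c ≠ 0 := fun h =>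
    ENNReal.mul_ne_top ENNReal.coe_ne_top ENNReal.ofReal_ne_top (expNeg_eq_zero.1 h)
  -- The Laplace functionals of the three laws.
  have hψ : ∀ φ : ℝ → ℝ≥0∞, Measurable φ → Measurable fun x => (Icc 0 b).indicator φ (x - s) :=
    fun φ hφ => (hφ.indicator measurableSet_Icc).comp (measurable_id.sub_const s)
  have hQ : ∀ φ : ℝ → ℝ≥0∞, Measurable φ → ∫⁻ μ, expNeg (∫⁻ x, φ x ∂μ.toMeasure) ∂Q =
      expNeg (γ₀ * ∫⁻ t in Ioi 0, hit (clusterLimit γ (fun x => (Icc 0 b).indicator φ (x - s)) t))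
      := fun φ hφ => by
    rw [lintegral_map (PointMeasure.measurable_expNeg_lintegral hφ) hRS]
    simp_rw [R, PointMeasure.lintegral_restrict_shift _ s measurableSet_Icc hφ]
    exact hN.lintegral_expNeg_superposition' measurableSet_Ioi (isUpperSet_Ioi 0) hγ hρ (hψ φ hφ)
  have hQ' : ∀ φ : ℝ → ℝ≥0∞, Measurable φ → ∫⁻ μ, expNeg (∫⁻ x, φ x ∂μ.toMeasure) ∂Q' =
      expNeg (γ₀ * ∫⁻ t, hit (clusterLimit γ (fun x => (Icc 0 b).indicator φ (x - s)) t))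
      := fun φ hφ => by
    rw [lintegral_map (PointMeasure.measurable_expNeg_lintegral hφ) hRS']
    simp_rw [R, PointMeasure.lintegral_restrict_shift _ s measurableSet_Icc hφ]
    rw [hN'.lintegral_expNeg_superposition' .univ isUpperSet_univ hγ hρ (hψ φ hφ),
      setLIntegral_univ]
  have hQM : ∀ φ : ℝ → ℝ≥0∞, Measurable φ → ∫⁻ μ, expNeg (∫⁻ x, φ x ∂μ.toMeasure) ∂QM =
      c * expNeg (γ₀ * ∫⁻ t in Iic 0,
        hit (clusterLimit γ (fun x => (Icc 0 b).indicator φ (x - s)) t)) := fun φ hφ => by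
    rw [lintegral_map (PointMeasure.measurable_expNeg_lintegral hφ) hRS',
      lintegral_withDensity_eq_lintegral_mul _ hw
        (by exact (PointMeasure.measurable_expNeg_lintegral hφ).comp hRS')]
    simp only [Pi.mul_apply, w]
    simp_rw [R, PointMeasure.lintegral_restrict_shift _ s measurableSet_Icc hφ]
    rw [hN'.lintegral_expNeg_superposition .univ isUpperSet_univ hγ hρ hχ (hψ φ hφ), ← expNeg_add,
      ← mul_add, setLIntegral_univ]
    set V := clusterLimit γ (fun x => (Icc 0 b).indicator φ (x - s))
    have hV : Measurable V := measurable_clusterLimit hγ (hψ φ hφ)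
    congr 2
    -- Immigrants in `(0, s + b]` are forbidden (`hit ∞ = 1`), those after `s + b` are invisible,
    -- and those up to `0` keep their cluster exponent.
    have h1 : ∀ t, hit (χ t + V t) =
        (Ioc 0 (s + b)).indicator 1 t + (Iic 0).indicator (fun t => hit (V t)) t := by
      intro t
      rcases le_or_gt t 0 with ht | ht
      · simp [χ, ht, ht.not_gt]
      · rcases le_or_gt t (s + b) with ht' | ht'
        · simp [χ, ht, ht', hit_top, ht.not_ge]
        · have h0 : V t = 0 := by
            refine clusterLimit_eq_zero (b := s + b) (fun x hx => indicator_of_notMem ?_ _) ht'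
            simp only [mem_Icc, not_and, not_le]
            intro
            linarith
          simp [χ, ht.not_ge, ht'.not_ge, h0, hit_zero]
    simp_rw [h1]
    rw [lintegral_add_left (measurable_one.indicator measurableSet_Ioc),
      lintegral_indicator_one measurableSet_Ioc, lintegral_indicator measurableSet_Iic,
      Real.volume_Ioc, sub_zero]
  -- The stationary process is an independent superposition.
  have hconv : c • Q' = (Q.prod QM).map fun p => p.1.add p.2 := by
    have : IsFiniteMeasure (c • Q') := Measure.smul_finite _ (expNeg_ne_top _)
    have hQf : IsFiniteMeasure Q := inferInstance
    have hQMf : IsFiniteMeasure QM := inferInstance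
    refine PointMeasure.ext_of_lintegral_expNeg fun φ hφ => ?_
    have hm := PointMeasure.measurable_expNeg_lintegral hφ
    rw [lintegral_smul_measure, lintegral_map hm PointMeasure.measurable_add, hQ' φ hφ]
    have h1 : ∀ p : PointMeasure × PointMeasure, expNeg (∫⁻ x, φ x ∂(p.1.add p.2).toMeasure) =
        expNeg (∫⁻ x, φ x ∂p.1.toMeasure) * expNeg (∫⁻ x, φ x ∂p.2.toMeasure) := fun p => by
      rw [← expNeg_add, PointMeasure.add, lintegral_add_measure]
    simp_rw [h1]
    rw [lintegral_prod_mul hm.aemeasurable hm.aemeasurable, hQ φ hφ, hQM φ hφ, smul_eq_mul,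
      ← lintegral_add_compl (A := Iic (0 : ℝ)) _ measurableSet_Iic, compl_Iic, mul_add,
      expNeg_add (γ₀ * _) (γ₀ * _)]
    ring
  -- Taking `φ = ∞` everywhere turns the Laplace functional into the mass of the zero measure.
  have hzero : c * (1 - γ₀ * ∫⁻ u in Iic (-s),
      hit (clusterLimit γ ((Icc 0 b).indicator fun _ => ∞) u)) ≤
      QM {ν | ν.toMeasure univ = 0} := by
    have hmeas : MeasurableSet {ν : PointMeasure | ν.toMeasure univ = 0} :=
      PointMeasure.measurable_apply .univ (measurableSet_singleton 0)
    have h1 : ∫⁻ u in Iic 0, hit (clusterLimit γ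
        (fun x => (Icc 0 b).indicator (fun _ => ∞) (x - s)) u) =
        ∫⁻ u in Iic (-s), hit (clusterLimit γ ((Icc 0 b).indicator fun _ => ∞) u) := by
      simp_rw [clusterLimit_comp_sub]
      rw [← lintegral_indicator measurableSet_Iic, ← lintegral_indicator measurableSet_Iic,
        ← lintegral_add_right_eq_self _ s]
      refine lintegral_congr fun x => ?_
      simp [indicator, le_neg_iff_add_nonpos_left, add_comm]
    calc _ ≤ ∫⁻ μ, expNeg (∫⁻ x, ∞ ∂μ.toMeasure) ∂QM := by
          rw [hQM _ measurable_const, h1]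
          gcongr
          exact one_sub_le_expNeg _
      _ ≤ ∫⁻ μ, {ν : PointMeasure | ν.toMeasure univ = 0}.indicator 1 μ ∂QM := by
          refine lintegral_mono fun μ => ?_
          by_cases h : μ.toMeasure univ = 0
          · rw [indicator_of_mem (by exact h)]
            exact expNeg_le_one _
          · rw [lintegral_const, ENNReal.top_mul h, expNeg_top]
            exact zero_le
      _ = _ := lintegral_indicator_one hmeas
  -- If the old immigrants contribute nothing, the superposition is its empty-history part.
  have hprod : Q A * QM {ν | ν.toMeasure univ = 0} ≤ c * Q' A := by
    have hSF : SFinite QM := inferInstance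
    calc Q A * QM {ν | ν.toMeasure univ = 0} = Q.prod QM (A ×ˢ {ν | ν.toMeasure univ = 0}) :=
          (Measure.prod_prod _ _).symm
      _ ≤ Q.prod QM ((fun p => p.1.add p.2) ⁻¹' A) := by
          refine measure_mono ?_
          rintro ⟨μ, ν⟩ ⟨hμ, hν⟩
          have h0 : ν.toMeasure = 0 := Measure.measure_univ_eq_zero.1 hν
          have : μ.add ν = μ := PointMeasure.ext_toMeasure (by simp [PointMeasure.add, h0])
          simpa only [mem_preimage, this] using hμ
      _ = c * Q' A := by
          rw [← Measure.map_apply PointMeasure.measurable_add hA, ← hconv]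
          simp
  refine (ENNReal.mul_le_mul_iff_right hc (expNeg_ne_top _)).1 ?_
  calc _ = c * (1 - γ₀ * ∫⁻ u in Iic (-s),
          hit (clusterLimit γ ((Icc 0 b).indicator fun _ => ∞) u)) * Q A := (mul_assoc _ _ _).symm
    _ ≤ QM {ν | ν.toMeasure univ = 0} * Q A := by gcongr
    _ ≤ c * Q' A := by rw [mul_comm]; exact hprod

end IsHawkesGenerations

end HawkesProcess

/-! ### Reduction to bounded windows -/

/-- For a directed infimum of topologies a neighbourhood of a point is already one for some `t b`,
so the interiors of `G` for the `t b` exhaust `G`. -/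
lemma exists_iUnion_of_isOpen_iInf {X : Type*} {t : ℕ → TopologicalSpace X} (ht : Antitone t)
    {G : Set X} (hG : IsOpen[⨅ b, t b] G) :
    ∃ U : ℕ → Set X, Monotone U ∧ (∀ b, IsOpen[t b] (U b)) ∧ ⋃ b, U b = G := by
  have hopen : ∀ b, IsOpen[t b] (@interior X (t b) G) := fun b => @isOpen_interior X (t b) G
  refine ⟨fun b => @interior X (t b) G, fun a b h => ?_, hopen, ?_⟩
  · exact @interior_maximal X (t b) G _ (@interior_subset X (t a) G) (ht h _ (hopen a))
  · refine subset_antisymm (iUnion_subset fun b => @interior_subset X (t b) G) fun x hx => ?_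
    have h1 := @IsOpen.mem_nhds X (⨅ b, t b) x G hG hx
    rw [nhds_iInf, mem_iInf_of_directed] at h1
    · obtain ⟨b, hb⟩ := h1
      exact mem_iUnion.2 ⟨b, (@mem_interior_iff_mem_nhds X (t b) x G).2 hb⟩
    · exact Antitone.directed_ge fun a b h => nhds_mono (ht h)

namespace PointMeasure

/-- The restriction of a point measure to `[-b, b]`. -/
noncomputable abbrev truncate (b : ℕ) : PointMeasure → PointMeasure :=
  restrict (Icc (-b : ℝ) b) measurableSet_Icc

lemma truncate_truncate {a b : ℕ} (h : a ≤ b) (μ : PointMeasure) :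
    truncate a (truncate b μ) = truncate a μ := by
  have h' : (a : ℝ) ≤ b := by exact_mod_cast h
  rw [truncate, truncate, restrict_restrict]
  congr 1
  exact inter_eq_left.2 (Icc_subset_Icc (neg_le_neg h') h')

lemma generateFrom_truncate : instMeasurableSpace = MeasurableSpace.generateFrom
    {B | ∃ (b : ℕ) (A : Set PointMeasure), MeasurableSet A ∧ truncate b ⁻¹' A = B} := by
  set 𝒜 := {B | ∃ (b : ℕ) (A : Set PointMeasure), MeasurableSet A ∧ truncate b ⁻¹' A = B}
  refine le_antisymm ?_ (MeasurableSpace.generateFrom_le ?_)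
  · have h : Measurable[MeasurableSpace.generateFrom 𝒜, instMeasurableSpace]
        (id : PointMeasure → PointMeasure) := by
      refine measurable_of_measurable_toMeasure (measurable_toMeasure_of_Ioo fun p q => ?_)
      obtain ⟨b, hb⟩ := exists_nat_ge (max |(p : ℝ)| |(q : ℝ)|)
      have hT : Measurable[MeasurableSpace.generateFrom 𝒜, instMeasurableSpace] (truncate b) :=
        fun A hA => MeasurableSpace.measurableSet_generateFrom ⟨b, A, hA, rfl⟩
      have h1 : ∀ μ : PointMeasure, μ.toMeasure (Ioo (p : ℝ) q) =
          (truncate b μ).toMeasure (Ioo (p : ℝ) q) := fun μ => by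
        simp only [truncate, restrict]
        rw [Measure.restrict_apply measurableSet_Ioo, inter_eq_left.2]
        have hp := (abs_le.1 ((le_max_left _ _).trans hb)).1
        have hq := (abs_le.1 ((le_max_right _ _).trans hb)).2
        exact Ioo_subset_Icc_self.trans (Icc_subset_Icc hp hq)
      rw [show (fun μ : PointMeasure => (id μ).toMeasure (Ioo (p : ℝ) q)) =
        fun μ => (truncate b μ).toMeasure (Ioo (p : ℝ) q) from funext h1]
      exact (measurable_apply measurableSet_Ioo).comp hT
    exact fun s hs => h hs
  · rintro _ ⟨b, A, hA, rfl⟩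
    exact measurable_restrict _ _ hA

lemma isSetAlgebra_truncate : IsSetAlgebra
    {B | ∃ (b : ℕ) (A : Set PointMeasure), MeasurableSet A ∧ truncate b ⁻¹' A = B} where
  empty_mem := ⟨0, ∅, .empty, rfl⟩
  compl_mem := by
    rintro _ ⟨b, A, hA, rfl⟩
    exact ⟨b, Aᶜ, hA.compl, rfl⟩
  union_mem := by
    rintro _ _ ⟨a, A, hA, rfl⟩ ⟨b, B, hB, rfl⟩
    refine ⟨max a b, truncate a ⁻¹' A ∪ truncate b ⁻¹' B,
      (measurable_restrict _ _ hA).union (measurable_restrict _ _ hB), ?_⟩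
    ext μ
    simp only [mem_preimage, mem_union, truncate_truncate (le_max_left a b),
      truncate_truncate (le_max_right a b)]

/-- Window events form an algebra generating the σ-algebra, so `A` is approximated by one of them
under `Q₁ + Q₂`, hence under both laws. It matters that `ε` does not depend on the window. -/
lemma measure_le_add_of_truncate {Q₁ Q₂ : Measure PointMeasure} [IsFiniteMeasure Q₁]
    [IsFiniteMeasure Q₂] {ε : ℝ≥0∞} (h : ∀ (b : ℕ) (A : Set PointMeasure), MeasurableSet A →
      Q₁ (truncate b ⁻¹' A) ≤ Q₂ (truncate b ⁻¹' A) + ε)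
    {A : Set PointMeasure} (hA : MeasurableSet A) : Q₁ A ≤ Q₂ A + ε := by
  have hd := Measure.MeasureDense.of_generateFrom_isSetAlgebra_finite (Q₁ + Q₂)
    isSetAlgebra_truncate generateFrom_truncate
  refine ENNReal.le_of_forall_pos_le_add fun δ hδ _ => ?_
  obtain ⟨t, ⟨b, B, hB, rfl⟩, ht⟩ := hd.approx A hA (measure_ne_top _ _) (δ / 2)
    (by exact_mod_cast half_pos hδ)
  set t := truncate b ⁻¹' B
  have h1 : Q₁ (A \ t) ≤ ENNReal.ofReal (δ / 2) :=
    (measure_mono subset_union_left).trans ((Measure.le_add_right le_rfl _).trans ht.le)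
  have h2 : Q₂ (t \ A) ≤ ENNReal.ofReal (δ / 2) :=
    (measure_mono subset_union_right).trans ((Measure.le_add_left le_rfl _).trans ht.le)
  calc Q₁ A ≤ Q₁ t + Q₁ (A \ t) := by
        refine (measure_mono fun x hx => ?_).trans (measure_union_le t (A \ t))
        by_cases hxt : x ∈ t
        · exact .inl hxt
        · exact .inr ⟨hx, hxt⟩
    _ ≤ Q₂ t + ε + ENNReal.ofReal (δ / 2) := add_le_add (h b B hB) h1
    _ ≤ Q₂ A + ENNReal.ofReal (δ / 2) + ε + ENNReal.ofReal (δ / 2) := by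
        gcongr
        refine (measure_mono fun x hx => ?_).trans ((measure_union_le A (t \ A)).trans
          (add_le_add le_rfl h2))
        by_cases hxA : x ∈ A
        · exact .inl hxA
        · exact .inr ⟨hx, hxA⟩
    _ = Q₂ A + ε + (ENNReal.ofReal (δ / 2) + ENNReal.ofReal (δ / 2)) := by ring
    _ = Q₂ A + ε + δ := by
        rw [← ENNReal.ofReal_add (by positivity) (by positivity), add_halves,
          ENNReal.ofReal_coe_nnreal]

/-- The topology generated by the test functions supported in `[-b, b]`. -/
noncomputable abbrev windowTopology (b : ℕ) : TopologicalSpace PointMeasure :=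
  TopologicalSpace.induced (fun (μ : PointMeasure)
    (φ : {φ : C_c(ℝ, ℝ) // ∀ x ∉ Icc (-b : ℝ) b, φ x = 0}) => ∫ x, φ.1 x ∂μ.toMeasure)
    inferInstance

lemma continuous_windowTopology {b : ℕ} {φ : C_c(ℝ, ℝ)} (h : ∀ x ∉ Icc (-b : ℝ) b, φ x = 0) :
    Continuous[windowTopology b, inferInstance]
      fun μ : PointMeasure => ∫ x, φ x ∂μ.toMeasure := by
  let τ : TopologicalSpace PointMeasure := windowTopology b
  exact (continuous_apply (⟨φ, h⟩ : {φ : C_c(ℝ, ℝ) // ∀ x ∉ Icc (-b : ℝ) b, φ x = 0})).comp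
    (continuous_induced_dom (f := fun (μ : PointMeasure)
      (φ : {φ : C_c(ℝ, ℝ) // ∀ x ∉ Icc (-b : ℝ) b, φ x = 0}) => ∫ x, φ.1 x ∂μ.toMeasure))

lemma le_windowTopology (b : ℕ) : instTopologicalSpace ≤ windowTopology b :=
  continuous_iff_le_induced.1 (continuous_pi fun φ => continuous_integral φ.1)

lemma windowTopology_antitone : Antitone windowTopology := fun a b h =>
  continuous_iff_le_induced.1 (@continuous_pi _ _ _ (windowTopology b) _ _ fun φ =>
    continuous_windowTopology fun x hx => φ.2 x fun hx' => hx (by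
      have h' : (a : ℝ) ≤ b := by exact_mod_cast h
      exact Icc_subset_Icc (neg_le_neg h') h' hx'))

lemma iInf_windowTopology : ⨅ b, windowTopology b = instTopologicalSpace := by
  refine le_antisymm ?_ (le_iInf le_windowTopology)
  refine continuous_iff_le_induced.1 (@continuous_pi _ _ _ (⨅ b, windowTopology b) _ _ fun φ => ?_)
  obtain ⟨R, hR⟩ := φ.hasCompactSupport.isCompact.isBounded.subset_closedBall 0
  obtain ⟨n, hn⟩ := exists_nat_ge R
  refine continuous_iInf_dom (i := n) (continuous_windowTopology fun x hx => ?_)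
  by_contra h
  have h1 := hR (subset_tsupport _ (Function.mem_support.2 h))
  rw [mem_closedBall_zero_iff, Real.norm_eq_abs] at h1
  exact hx (abs_le.1 (h1.trans hn))

/-- Truncation does not change the integrals of functions supported in `[-b, b]`. -/
lemma preimage_truncate_of_isOpen {b : ℕ} {U : Set PointMeasure} (hU : IsOpen[windowTopology b] U) :
    truncate b ⁻¹' U = U := by
  obtain ⟨V, -, rfl⟩ := isOpen_induced_iff.1 hU
  ext μ
  simp only [mem_preimage]
  refine iff_of_eq (congrArg (· ∈ V) (funext fun φ => ?_))
  simp only [truncate, restrict]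
  exact setIntegral_eq_integral_of_forall_compl_eq_zero fun x hx => φ.2 x hx

/-- A vaguely open set is an increasing union of vaguely open sets which depend on bounded
windows only. -/
lemma exists_open_iUnion_truncate {G : Set PointMeasure} (hG : IsOpen G) :
    ∃ U : ℕ → Set PointMeasure, Monotone U ∧ (∀ b, IsOpen (U b)) ∧
      (∀ b, truncate b ⁻¹' U b = U b) ∧ ⋃ b, U b = G := by
  rw [← iInf_windowTopology] at hG
  obtain ⟨U, hUm, hUo, hU⟩ := exists_iUnion_of_isOpen_iInf windowTopology_antitone hG
  exact ⟨U, hUm, fun b => le_windowTopology b _ (hUo b),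
    fun b => preimage_truncate_of_isOpen (hUo b), hU⟩

lemma truncate_restrictNonneg (b : ℕ) (μ : PointMeasure) :
    truncate b μ.restrictNonneg = μ.restrict (Icc 0 (b : ℝ)) measurableSet_Icc := by
  have h : Icc (-b : ℝ) b ∩ Ici 0 = Icc 0 (b : ℝ) := by
    have hb : (0 : ℝ) ≤ b := Nat.cast_nonneg b
    ext x
    exact ⟨fun hx => ⟨hx.2, hx.1.2⟩, fun hx => ⟨⟨by linarith [hx.1], hx.2⟩, hx.1⟩⟩
  refine (restrict_restrict measurableSet_Icc measurableSet_Ici μ).trans (ext_toMeasure ?_)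
  simp only [restrict, h]

lemma measurable_restrictNonneg : Measurable restrictNonneg :=
  measurable_restrict _ measurableSet_Ici

lemma map_restrictNonneg_preimage_truncate {Ω : Type*} [MeasurableSpace Ω] (P : Measure Ω)
    {S : Ω → PointMeasure} (hS : Measurable S) (b : ℕ) {A : Set PointMeasure}
    (hA : MeasurableSet A) :
    P.map (fun ω => (S ω).restrictNonneg) (truncate b ⁻¹' A) =
      P.map (fun ω => (S ω).restrict (Icc 0 (b : ℝ)) measurableSet_Icc) A := by
  have h1 : Measurable fun ω => (S ω).restrictNonneg := measurable_restrictNonneg.comp hS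
  have h2 : Measurable fun ω => (S ω).restrict (Icc 0 (b : ℝ)) measurableSet_Icc :=
    (measurable_restrict _ measurableSet_Icc).comp hS
  rw [Measure.map_apply h1 (measurable_restrict _ _ hA), Measure.map_apply h2 hA]
  refine congrArg P (Set.ext fun ω => ?_)
  exact iff_of_eq (congrArg (· ∈ A) (truncate_restrictNonneg b (S ω)))

end PointMeasure

/-! ### Convergence in distribution and in variation -/

section Convergence

variable {Ω Ω' : Type*} [MeasurableSpace Ω] [MeasurableSpace Ω'] {P : Measure Ω}
  [IsProbabilityMeasure P] {P' : Measure Ω'} [IsProbabilityMeasure P'] {γ₀ : ℝ≥0}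
  {γ : ℕ → ℝ → ℝ≥0} {N : ℕ → Ω → PointMeasure} {N' : ℕ → Ω' → PointMeasure}

/-- Both laws have mass `1`, so the one-sided comparison on complements gives the reverse
comparison. -/
lemma prob_compl_le_add {E : Type*} [MeasurableSpace E] {Q₁ Q₂ : Measure E}
    [IsProbabilityMeasure Q₁] [IsProbabilityMeasure Q₂] {ε : ℝ≥0∞} {B : Set E}
    (hB : MeasurableSet B) (h : Q₁ B ≤ Q₂ B + ε) : Q₂ Bᶜ ≤ Q₁ Bᶜ + ε := by
  have h1 := prob_add_prob_compl (μ := Q₁) hB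
  have h2 := prob_add_prob_compl (μ := Q₂) hB
  refine (ENNReal.add_le_add_iff_left (measure_ne_top Q₁ B)).1 ?_
  calc Q₁ B + Q₂ Bᶜ ≤ Q₂ B + ε + Q₂ Bᶜ := by gcongr
    _ = 1 + ε := by rw [add_right_comm, h2]
    _ = Q₁ B + (Q₁ Bᶜ + ε) := by rw [← add_assoc, h1]

lemma le_add_of_one_sub_mul_le {ε p q : ℝ≥0∞} (h : (1 - ε) * p ≤ q) (hp : p ≤ 1) :
    p ≤ q + ε := by
  calc p = 1 * p := (one_mul _).symm
    _ ≤ ((1 - ε) + ε) * p := by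
        gcongr
        exact le_tsub_add
    _ ≤ q + ε := by
        rw [add_mul]
        exact add_le_add h (mul_le_of_le_one_right' hp)

/-- On a bounded window the laws of the two processes are close in variation. -/
lemma IsHawkesGenerations.map_truncate_le_add (hN : IsHawkesGenerations P (Ioi 0) γ₀ γ N)
    (hN' : IsHawkesGenerations P' univ γ₀ γ N') (hγ : ∀ n, Measurable (γ (n + 1)))
    (hρ : (⨆ n : ℕ, ∫⁻ t in Ioi (0 : ℝ), (γ (n + 1) t : ℝ≥0∞)) < 1) (s : ℝ) (b : ℕ)
    {A : Set PointMeasure} (hA : MeasurableSet A) :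
    P.map (fun ω => ((PointMeasure.superposition fun n => N n ω).shift s).restrictNonneg)
        (PointMeasure.truncate b ⁻¹' A) ≤
      P'.map (fun ω => (PointMeasure.superposition fun n => N' n ω).restrictNonneg)
        (PointMeasure.truncate b ⁻¹' A) +
      γ₀ * ∫⁻ u in Iic (-s), hit (clusterLimit γ ((Icc 0 (b : ℝ)).indicator fun _ => ∞) u) := by
  have hS : Measurable fun ω => (PointMeasure.superposition fun n => N n ω).shift s :=
    (PointMeasure.measurable_shift s).comp
      (PointMeasure.measurable_superposition hN.measurable)
  have key := hN.map_window_le hN' hγ hρ s b hA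
  rw [hN'.map_shift_restrict_eq hγ hρ s measurableSet_Icc] at key
  rw [PointMeasure.map_restrictNonneg_preimage_truncate P hS b hA,
    PointMeasure.map_restrictNonneg_preimage_truncate P'
      (PointMeasure.measurable_superposition hN'.measurable) b hA]
  refine le_add_of_one_sub_mul_le key ?_
  have hX : Measurable fun ω => ((PointMeasure.superposition fun n => N n ω).shift s).restrict
      (Icc 0 (b : ℝ)) measurableSet_Icc := (PointMeasure.measurable_restrict _ _).comp hS
  rw [Measure.map_apply hX hA]
  exact prob_le_one

lemma tendsto_mul_setLIntegral_hit_clusterLimit (hγ : ∀ n, Measurable (γ (n + 1)))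
    {C : Set ℝ} (hC : MeasurableSet C)
    (h : ∫⁻ u in Iio 0, hit (clusterLimit γ (C.indicator fun _ => ∞) u) ≠ ∞) :
    Tendsto (fun s : ℝ => γ₀ * ∫⁻ u in Iic (-s), hit (clusterLimit γ (C.indicator fun _ => ∞) u))
      atTop (𝓝 0) := by
  simpa using ENNReal.Tendsto.const_mul (tendsto_setLIntegral_Iic_neg
    (measurable_clusterLimit hγ (measurable_const.indicator hC)).hit h)
    (.inr (ENNReal.coe_ne_top (r := γ₀)))

/-- By the portmanteau criterion only lower bounds on open sets are needed. The window `b` is fixed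
before `s → ∞`, so the error may depend on it, and no moment condition is used. -/
theorem IsHawkesGenerations.tendstoInDistribution (hN : IsHawkesGenerations P (Ioi 0) γ₀ γ N)
    (hN' : IsHawkesGenerations P' univ γ₀ γ N') (hγ : ∀ n, Measurable (γ (n + 1)))
    (hρ : (⨆ n : ℕ, ∫⁻ t in Ioi (0 : ℝ), (γ (n + 1) t : ℝ≥0∞)) < 1) :
    TendstoInDistribution
      (fun (s : ℝ) ω => ((PointMeasure.superposition fun n => N n ω).shift s).restrictNonneg) atTop
      (fun ω => (PointMeasure.superposition fun n => N' n ω).restrictNonneg) (fun _ => P) P' := by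
  have hR := PointMeasure.measurable_restrictNonneg
  have hX : ∀ s, Measurable fun ω =>
      ((PointMeasure.superposition fun n => N n ω).shift s).restrictNonneg := fun s =>
    hR.comp ((PointMeasure.measurable_shift s).comp
      (PointMeasure.measurable_superposition hN.measurable))
  have hY : Measurable fun ω => (PointMeasure.superposition fun n => N' n ω).restrictNonneg :=
    hR.comp (PointMeasure.measurable_superposition hN'.measurable)
  refine ⟨fun s => (hX s).aemeasurable, hY.aemeasurable, ?_⟩
  refine tendsto_of_forall_isOpen_le_liminf' fun G hG => ?_
  obtain ⟨U, hUm, hUo, hUt, rfl⟩ := PointMeasure.exists_open_iUnion_truncate hG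
  rw [hUm.measure_iUnion]
  refine iSup_le fun b => ?_
  have hε := tendsto_mul_setLIntegral_hit_clusterLimit (γ₀ := γ₀) hγ
    (C := Icc 0 (b : ℝ)) measurableSet_Icc (by
      refine ne_top_of_le_ne_top ?_ ((setLIntegral_le_lintegral _ _).trans
        (lintegral_hit_clusterLimit_le hγ hρ (measurable_const.indicator measurableSet_Icc)))
      refine ENNReal.mul_ne_top ?_ (ENNReal.inv_ne_top.2 (tsub_pos_of_lt hρ).ne')
      -- Although `φ = ∞` on the window, `hit φ` is at most `1` there, so its integral is at most
      -- the length of the window.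
      refine ne_top_of_le_ne_top ?_ (lintegral_mono (g := (Icc 0 (b : ℝ)).indicator 1) fun x => ?_)
      · rw [lintegral_indicator_one measurableSet_Icc]
        simp
      · by_cases hx : x ∈ Icc 0 (b : ℝ)
        · rw [indicator_of_mem hx, indicator_of_mem hx]
          exact hit_le_one _
        · simp [indicator_of_notMem hx, hit_zero])
  have hlim := ENNReal.Tendsto.sub (tendsto_const_nhds (x := P'.map (fun ω =>
    (PointMeasure.superposition fun n => N' n ω).restrictNonneg) (U b))) hε (.inr (by simp))
  rw [tsub_zero] at hlim
  refine hlim.liminf_eq.symm.le.trans (liminf_le_liminf (.of_forall fun s => ?_))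
  have : IsProbabilityMeasure (P.map fun ω =>
      ((PointMeasure.superposition fun n => N n ω).shift s).restrictNonneg) :=
    Measure.isProbabilityMeasure_map (hX s).aemeasurable
  have : IsProbabilityMeasure (P'.map fun ω =>
      (PointMeasure.superposition fun n => N' n ω).restrictNonneg) :=
    Measure.isProbabilityMeasure_map hY.aemeasurable
  have h1 := prob_compl_le_add (PointMeasure.measurable_restrict _ _ (hUo b).measurableSet.compl)
    (hN.map_truncate_le_add hN' hγ hρ s b (hUo b).measurableSet.compl)
  rw [preimage_compl, compl_compl, hUt] at h1
  exact tsub_le_iff_right.2 (h1.trans (add_le_add (measure_mono (subset_iUnion U b)) le_rfl))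

theorem IsHawkesGenerations.tendstoInVariation (hN : IsHawkesGenerations P (Ioi 0) γ₀ γ N)
    (hN' : IsHawkesGenerations P' univ γ₀ γ N') (hγ : ∀ n, Measurable (γ (n + 1)))
    (hρ : (⨆ n : ℕ, ∫⁻ t in Ioi (0 : ℝ), (γ (n + 1) t : ℝ≥0∞)) < 1)
    (hη : (⨆ n : ℕ, ∫⁻ t in Ioi (0 : ℝ), ENNReal.ofReal t * (γ (n + 1) t : ℝ≥0∞)) < ∞) :
    TendstoInVariation
      (fun (s : ℝ) ω => ((PointMeasure.superposition fun n => N n ω).shift s).restrictNonneg)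
      (fun ω => (PointMeasure.superposition fun n => N' n ω).restrictNonneg) P P' := by
  have hR := PointMeasure.measurable_restrictNonneg
  have hX : ∀ s, Measurable fun ω =>
      ((PointMeasure.superposition fun n => N n ω).shift s).restrictNonneg := fun s =>
    hR.comp ((PointMeasure.measurable_shift s).comp
      (PointMeasure.measurable_superposition hN.measurable))
  have hY : Measurable fun ω => (PointMeasure.superposition fun n => N' n ω).restrictNonneg :=
    hR.comp (PointMeasure.measurable_superposition hN'.measurable)
  have hC : Measurable ((Ici (0 : ℝ)).indicator fun _ => (∞ : ℝ≥0∞)) :=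
    measurable_const.indicator measurableSet_Ici
  -- The error for the infinite window `[0, ∞)` dominates those of all bounded windows; the
  -- first-moment condition makes it finite for large `s` and makes it vanish in the limit.
  set ε : ℝ → ℝ≥0∞ := fun s =>
    γ₀ * ∫⁻ u in Iic (-s), hit (clusterLimit γ ((Ici 0).indicator fun _ => ∞) u)
  have hε : Tendsto ε atTop (𝓝 0) :=
    tendsto_mul_setLIntegral_hit_clusterLimit hγ measurableSet_Ici
      (ne_top_of_le_ne_top
        (ENNReal.mul_ne_top hη.ne (ENNReal.inv_ne_top.2 (tsub_pos_of_lt hρ).ne'))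
        (setLIntegral_hit_clusterLimit_le hγ hC fun n =>
          setLIntegral_Iio_hit_clusterExponent_le hγ hρ hC (fun s hs => by simp [hs]) n 0))
  have hle : ∀ s A, MeasurableSet A → ε s ≠ ∞ →
      |P.real {ω | ((PointMeasure.superposition fun n => N n ω).shift s).restrictNonneg ∈ A} -
        P'.real {ω | (PointMeasure.superposition fun n => N' n ω).restrictNonneg ∈ A}| ≤
      (ε s).toReal := by
    intro s A hA hs
    set Q₁ := P.map fun ω =>
      ((PointMeasure.superposition fun n => N n ω).shift s).restrictNonneg
    set Q₂ := P'.map fun ω => (PointMeasure.superposition fun n => N' n ω).restrictNonneg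
    have : IsProbabilityMeasure Q₁ := Measure.isProbabilityMeasure_map (hX s).aemeasurable
    have : IsProbabilityMeasure Q₂ := Measure.isProbabilityMeasure_map hY.aemeasurable
    have h1 : ∀ A, MeasurableSet A → Q₁ A ≤ Q₂ A + ε s := fun A hA =>
      PointMeasure.measure_le_add_of_truncate (fun b B hB =>
        (hN.map_truncate_le_add hN' hγ hρ s b hB).trans (by
          refine add_le_add le_rfl (mul_le_mul' le_rfl (lintegral_mono fun u =>
            hit_mono (clusterLimit_mono (fun x => ?_) u)))
          exact indicator_le_indicator_of_subset Icc_subset_Ici_self (fun _ => zero_le) x)) hA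
    have h2 : Q₂ A ≤ Q₁ A + ε s := by
      simpa using prob_compl_le_add hA.compl (h1 Aᶜ hA.compl)
    have e1 : P.real {ω | ((PointMeasure.superposition fun n => N n ω).shift s).restrictNonneg ∈ A}
        = (Q₁ A).toReal := congrArg _ (Measure.map_apply (hX s) hA).symm
    have e2 : P'.real {ω | (PointMeasure.superposition fun n => N' n ω).restrictNonneg ∈ A}
        = (Q₂ A).toReal := congrArg _ (Measure.map_apply hY hA).symm
    rw [e1, e2, abs_sub_le_iff]
    have h3 := ENNReal.toReal_mono (by simp [hs]) (h1 A hA)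
    have h4 := ENNReal.toReal_mono (by simp [hs]) h2
    rw [ENNReal.toReal_add (by simp) hs] at h3 h4
    constructor <;> linarith
  refine tendsto_of_tendsto_of_tendsto_of_le_of_le' tendsto_const_nhds
    ((ENNReal.tendsto_toReal (by simp)).comp hε) (.of_forall fun s => ?_) ?_
  · exact Real.iSup_nonneg fun A => abs_nonneg _
  · filter_upwards [hε.eventually (gt_mem_nhds ENNReal.zero_lt_top)] with s hs
    exact Real.iSup_le (fun A => hle s A.1 A.2 hs.ne) ENNReal.toReal_nonneg

end Convergence
theorem mainTheorem1
    {Ω Ω' : Type*} [MeasurableSpace Ω] [MeasurableSpace Ω']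
    (P : Measure Ω) [IsProbabilityMeasure P] (P' : Measure Ω') [IsProbabilityMeasure P']
    (γ₀ : ℝ≥0) (hγ₀ : 0 < γ₀)
    (γ : ℕ → ℝ → ℝ≥0) (hγ : ∀ n, Measurable (γ (n + 1)))
    -- the exciting functions satisfy `sup_{n ≥ 1} ∫₀^∞ γ_n(t) dt < 1`
    (hρ : (⨆ n : ℕ, ∫⁻ t in Ioi (0 : ℝ), (γ (n + 1) t : ℝ≥0∞)) < 1)
    -- the generations of the process with empty history
    (N : ℕ → Ω → PointMeasure) (hN : IsHawkesGenerations P (Ioi 0) γ₀ γ N)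
    -- the generations of the stationary version
    (N' : ℕ → Ω' → PointMeasure) (hN' : IsHawkesGenerations P' univ γ₀ γ N') :
    -- both processes `∑ n, N n` are almost surely locally finite
    (∀ᵐ ω ∂P, IsPointMeasure (Measure.sum fun n => (N n ω).toMeasure)) ∧
    (∀ᵐ ω ∂P', IsPointMeasure (Measure.sum fun n => (N' n ω).toMeasure)) ∧
    -- weak convergence
    TendstoInDistribution
      (fun (s : ℝ) ω =>
        ((PointMeasure.superposition fun n => N n ω).shift s).restrictNonneg)
      atTop
      (fun ω => (PointMeasure.superposition fun n => N' n ω).restrictNonneg)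
      (fun _ => P) P' ∧
    -- strong convergence
    ((⨆ n : ℕ, ∫⁻ t in Ioi (0 : ℝ), ENNReal.ofReal t * (γ (n + 1) t : ℝ≥0∞)) < ∞ →
      TendstoInVariation
        (fun (s : ℝ) ω =>
          ((PointMeasure.superposition fun n => N n ω).shift s).restrictNonneg)
        (fun ω => (PointMeasure.superposition fun n => N' n ω).restrictNonneg)
        P P') := by
  exact ⟨hN.ae_isPointMeasure measurableSet_Ioi (isUpperSet_Ioi 0) hγ hρ,
    hN'.ae_isPointMeasure .univ isUpperSet_univ hγ hρ, hN.tendstoInDistribution hN' hγ hρ,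
    hN.tendstoInVariation hN' hγ hρ⟩
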